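/- **Games.** Let $\mathcal S=[n]$ and $\mathcal A=[m]$ ($n,m\ge1$), $s_{\rm init}=1$, $s_{\rm term}=n$. A turn-taking stochastic game consists of acting players $\mathsf{ap}(s)\in\{1,2\}$, rewards $r_i(s,a)\in[0,1]$ and transition probabilities $P(s,a,s')$ that are acyclic: $P(s,a,s')>0$ only if $s'>s$ or $s=s'=n$; moreover $r_i(n,a)=0$ and $P(n,a,n)=1$. A history is a sequence $h=(s_1,a_1,\dots,s_t,a_t)$, $t\le n$, of consecutive steps of a play (starting in any state), i.e. $s_{i+1}>s_i$ or $s_i=s_{i+1}=n$; a state $s$ may follow $h$ if $s>s_t$ or $s=s_t=n$ (any $s$ may follow $\emptyset$). **Strategies.** A deterministic strategy $\pi$ maps each pair $(h,s)$ to an action; a randomized strategy $\Pi$ is a distribution over deterministic ones. A history $h$ is admissible under $\pi$ if $\pi((s_1,a_1,\dots,s_{j-1},a_{j-1}),s_j)=a_j$ for all $j$, and admissible under $\Pi$ ($h\in\mathcal H^\Pi$) if it is admissible under some $\pi$ in the support of $\Pi$; $\Pi\mid h$ is $\Pi$ conditioned on $h$ being admissible under $\pi$. Let $u_i^\pi(h,s)$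 be the expected total reward of player $i$ over the next $n$ steps when play is in $s$ after $h$ and follows $\pi$, let $v_i^\Pi(h,s)=\mathbb E_{\pi\sim\Pi}[u_i^\pi(h,s)]$, and let $u_i^\Pi(h,s)=v_i^{\Pi\mid h}(h,s)$. **Feasibility.** For $i\in\{1,2\}$ let $\pi_i:\mathcal S\to\mathcal A$ be any history-independent deterministic subgame-perfect equilibrium of the zero-sum game in which player $i$ has rewards $r_i$ and the other player has rewards $-r_i$. With $i=\mathsf{ap}(s)$, put $u^p(s)=\max_{a'}\bigl(r_i(s,a')+\mathbb E_{s'\sim P(s,a')}[u_i^{\pi_i}((s,a'),s')]\bigr)$. $\Pi$ is $\varepsilon$-feasible if $v_{\mathsf{ap}(s)}^{\Pi\mid(h+(s,a))}(h,s)\ge u^p(s)-\varepsilon$ for all $h,s,a$ such that $h+(s,a)$ is a history in $\mathcal H^\Pi$. **Optimization algorithm.** The input is a game, an objective direction $\alpha_{\rm obj}\in\mathbb R_+^2\setminus\{0\}$ with $\|\alpha_{\rm obj}\|_1\le1$, and $\varepsilon>0$. Every argmax over actions, here and in the decoding algorithm, uses one fixed arbitrary rule that selects an action with the largest score from the list of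 scores. Let $\hat u(s)=u^p(s)-\frac{n-s-1}{n}\varepsilon$. For points $p,q\in\mathbb R^2$ let $\max^k\{p,q\}$ be $p$ if $q_k<p_k$ and $q$ otherwise, except that it is $p$ whenever $p=(-n,-n)$ (the value that marks an action without a feasible point). Evaluations are defined by $\mathcal D(n,a,\alpha)=(0,0)$ and, for $s<n$, $$\mathcal D(s,a,\alpha)=(r_1(s,a),r_2(s,a))+\sum_{s'>s}P(s,a,s')\,q_{s'},\qquad q_{s'}=q_{s',b},\quad b=\operatorname*{argmax}_{a'}\alpha\cdot q_{s',a'},$$ where $q_{s',a'}=\max^{\mathsf{ap}(s')}\{p_{s',a'},\mathcal D(s',a',\alpha)\}$. Set $p_{n,a}=(0,0)$ and $\ell_{n,a}=r_{n,a}=\alpha_{\rm obj}$. For $s=n-1,\dots,1$ and each $a$, let $i=\mathsf{ap}(s)$, $\ell=e_i$ (the $i$-th unit vector), $r=\alpha_{\rm obj}$, $q_\ell=\mathcal D(s,a,\ell)$, $q_r=\mathcal D(s,a,r)$. * If $(q_r)_i\ge\hat u(s)$, set $p_{s,a}=q_r$ and $\ell_{s,a}=r_{s,a}=\alpha_{\rm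 obj}$. * Otherwise, if $(q_\ell)_i<\hat u(s)$, set $p_{s,a}=(-n,-n)$ and $\ell_{s,a}=r_{s,a}=\alpha_{\rm obj}$. * Otherwise, while $\|\ell-r\|_1\ge\frac{\varepsilon}{10n^2}$, replace $\ell$ by $\frac{\ell+r}2$ if $\mathcal D(s,a,\frac{\ell+r}2)_i\ge\hat u(s)$, and replace $r$ by $\frac{\ell+r}2$ otherwise. Then set $\ell_{s,a}=\ell$, $r_{s,a}=r$, recompute $q_\ell=\mathcal D(s,a,\ell)$ and $q_r=\mathcal D(s,a,r)$, and set $p_{s,a}=\frac{(q_\ell)_i-\hat u(s)}{(q_\ell)_i-(q_r)_i}q_r+\frac{\hat u(s)-(q_r)_i}{(q_\ell)_i-(q_r)_i}q_\ell$. The computed objective value is $\mathrm{opt}=\max_a\alpha_{\rm obj}\cdot p_{s_{\rm init},a}$. **Decoding algorithm.** Let $\mathrm{val}(s,a,\alpha)=\max^{\mathsf{ap}(s)}\{p_{s,a},\mathcal D(s,a,\alpha)\}$ and let $\mathrm{best}(s,\alpha)=\operatorname*{argmax}_a\alpha\cdot\mathrm{val}(s,a,\alpha)$. The input is $(h,s)$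 with $h=(s_1,a_1,\dots,s_t,a_t)$. 1. If $h=\emptyset$, return $\operatorname*{argmax}_a\alpha_{\rm obj}\cdot p_{s,a}$. Otherwise, if $a_1\ne\operatorname*{argmax}_a\alpha_{\rm obj}\cdot p_{s_1,a}$, return $-1$; else start with direction $\alpha=\alpha_{\rm obj}$ and point $q=p_{s_1,a_1}$. 2. After each step $(s_i,a_i)$, $i=1,\dots,t$: if $q=p_{s_i,a_i}$, the direction $\alpha$ is replaced by $\ell_{s_i,a_i}$ with probability $\lambda$ and by $r_{s_i,a_i}$ with probability $1-\lambda$, where $\lambda=\frac{(q_r)_k-q_k}{(q_r)_k-(q_\ell)_k}$, $k=\mathsf{ap}(s_i)$, $q_\ell=\mathcal D(s_i,a_i,\ell_{s_i,a_i})$, $q_r=\mathcal D(s_i,a_i,r_{s_i,a_i})$ ($\lambda=0$ if $(q_r)_k=(q_\ell)_k$); otherwise $\alpha$ is kept. The action recommended in the next state $s'$ is $\mathrm{best}(s',\alpha)$. If $i<t$, then $s'=s_{i+1}$ and $q$ becomes $\mathrm{val}(s_{i+1},a_{i+1},\alpha)$. 3. The random choices are conditioned on the recommendation in $s_{i+1}$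 being $a_{i+1}$ for each $i<t$. If this event has probability $0$, return $-1$. Otherwise return the action recommended in $s$ after the last step, drawn from the conditional distribution. **Theorem.** There is a randomized strategy $\Pi$ output by the decoding algorithm, i.e. one such that, for every history $h$ and every state $s$ that may follow $h$: if $h\in\mathcal H^\Pi$, the algorithm returns on input $(h,s)$ a random action with the law of $\pi(h,s)$ for $\pi\sim\Pi\mid h$; and if $h\notin\mathcal H^\Pi$, it returns $-1$. Every such $\Pi$ is $\varepsilon$-feasible and satisfies $$\alpha_{\rm obj}\cdot\bigl(u_1^\Pi(\emptyset,s_{\rm init}),u_2^\Pi(\emptyset,s_{\rm init})\bigr)=\mathrm{opt}.$$ -/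

import Mathlib

noncomputable section

namespace TurnTaking

/-- States `1, …, n` with `n = N + 1`; the state numbered `k` is the element `k - 1` of
`Fin (N + 1)`.  The initial state is `0` and the terminal state is `Fin.last N`. -/
abbrev State (N : ℕ) := Fin (N + 1)

/-- The two players; player `1` is `0` and player `2` is `1`. -/
abbrev Player := Fin 2

/-- Points of the plane: pairs of utilities, and directions. -/
abbrev Pt := Fin 2 → ℝ

/-- Admissible consecutive states of a play: strictly later, or both terminal. -/
def Later {N : ℕ} (s t : State N) : Prop :=
  s < t ∨ (s = Fin.last N ∧ t = Fin.last N)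

/-- A two-player finite-horizon turn-taking stochastic game with `N + 1` states, `m` actions and
acyclic transitions. -/
structure Game (N m : ℕ) where
  ap : State N → Player
  r : Player → State N → Fin m → ℝ
  P : State N → Fin m → State N → ℝ
  r_nonneg : ∀ i s a, 0 ≤ r i s a
  r_le_one : ∀ i s a, r i s a ≤ 1
  P_nonneg : ∀ s a t, 0 ≤ P s a t
  P_sum : ∀ s a, ∑ t, P s a t = 1
  acyclic : ∀ s a t, 0 < P s a t → Later s t
  term_r : ∀ i a, r i (Fin.last N) a = 0
  term_P : ∀ a, P (Fin.last N) a (Fin.last N) = 1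

/-! ### Histories, strategies, utilities -/

/-- Finite sequences of state-action pairs. -/
abbrev Hist (N m : ℕ) := List (State N × Fin m)

/-- `(h, s)` is a history-state pair: `h` has length at most `n = N + 1`, and the states of `h`
followed by `s` are consecutive states of a play of an acyclic game. -/
def IsHistState {N m : ℕ} (h : Hist N m) (s : State N) : Prop :=
  h.length ≤ N + 1 ∧ (h.map Prod.fst ++ [s]).IsChain Later

/-- `h` is a history: at most `n = N + 1` steps, consecutive in a play of an acyclic game. -/
def IsHist {N m : ℕ} (h : Hist N m) : Prop :=
  h.length ≤ N + 1 ∧ (h.map Prod.fst).IsChain Later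

/-- Deterministic history-dependent strategies (of both players together).  The values on sequences
that are not histories play no role. -/
abbrev Strategy (N m : ℕ) := Hist N m → State N → Fin m

/-- Randomized strategies: distributions over deterministic strategies. -/
abbrev RStrategy (N m : ℕ) := PMF (Strategy N m)

/-- `h` is admissible under the deterministic strategy `π`: each action in `h` is the one that `π`
specifies after the steps preceding it. -/
def Admits {N m : ℕ} (π : Strategy N m) (h : Hist N m) : Prop :=
  ∀ (t : ℕ) (ht : t < h.length), π (h.take t) (h[t]).1 = (h[t]).2

/-- `h` is admissible under the randomized strategy `μ`: it is admissible under some deterministic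
strategy in the support of `μ`. -/
def RAdmits {N m : ℕ} (μ : RStrategy N m) (h : Hist N m) : Prop :=
  ∃ π ∈ {π : Strategy N m | Admits π h}, π ∈ μ.support

/-- The empty history is admissible. -/
theorem rAdmits_nil {N m : ℕ} (μ : RStrategy N m) : RAdmits μ [] := by
  obtain ⟨π, hπ⟩ := μ.support_nonempty
  exact ⟨π, fun t ht => absurd ht (by simp), hπ⟩

/-- The conditional version `μ ∣ h` of `μ`, for an admissible history `h`. -/
def cond {N m : ℕ} (μ : RStrategy N m) (h : Hist N m) (H : RAdmits μ h) : RStrategy N m :=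
  μ.filter {π | Admits π h} H

/-- Expected total reward, for the reward function `ρ`, of the next `k` steps of the play that is in
state `s` after `h` and follows `π`. -/
def reward {N m : ℕ} (G : Game N m) (ρ : State N → Fin m → ℝ) (π : Strategy N m) :
    ℕ → Hist N m → State N → ℝ
  | 0, _, _ => 0
  | k + 1, h, s =>
      ρ s (π h s) + ∑ t, G.P s (π h s) t * reward G ρ π k (h ++ [(s, π h s)]) t

/-- The onward utility (total over `n = N + 1` steps) under a deterministic strategy, for the reward
function `ρ`. -/
def onward {N m : ℕ} (G : Game N m) (ρ : State N → Fin m → ℝ) (π : Strategy N m)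
    (h : Hist N m) (s : State N) : ℝ :=
  reward G ρ π (N + 1) h s

/-- The onward utility `u_i^π(h, s)` of player `i` under a deterministic strategy. -/
def utilDet {N m : ℕ} (G : Game N m) (π : Strategy N m) (i : Player)
    (h : Hist N m) (s : State N) : ℝ :=
  onward G (G.r i) π h s

/-- The unconditional onward utility `v_i^μ(h, s)`. -/
def utilUncond {N m : ℕ} (G : Game N m) (μ : RStrategy N m) (i : Player)
    (h : Hist N m) (s : State N) : ℝ :=
  ∑' π, (μ π).toReal * utilDet G π i h s

/-- The actual onward utility `u_i^μ(h, s) = v_i^{μ ∣ h}(h, s)`. -/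
def util {N m : ℕ} (G : Game N m) (μ : RStrategy N m) (i : Player)
    (h : Hist N m) (H : RAdmits μ h) (s : State N) : ℝ :=
  utilUncond G (cond μ h H) i h s

/-! ### Punishment and feasibility -/

/-- The strategy `(j : π', 3 - j : π)`. -/
def combine {N m : ℕ} (G : Game N m) (j : Player) (π' π : Strategy N m) : Strategy N m :=
  fun h s => if G.ap s = j then π' h s else π h s

/-- The rewards of player `j` in the zero-sum game in which player `i` is punished: player `i` keeps
the rewards `r_i` and the other player gets `-r_i`. -/
def zeroSum {N m : ℕ} (G : Game N m) (i j : Player) : State N → Fin m → ℝ :=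
  fun s a => if j = i then G.r i s a else -G.r i s a

/-- The history-independent strategy that plays `σ s` in state `s`. -/
def stationary {N m : ℕ} (σ : State N → Fin m) : Strategy N m := fun _ s => σ s

/-- `σ` is a (history-independent, deterministic) subgame-perfect equilibrium of the zero-sum game in
which player `i` is punished: after no history can a player gain by deviating. -/
def IsPunishment {N m : ℕ} (G : Game N m) (i : Player) (σ : State N → Fin m) : Prop :=
  ∀ (j : Player) (π' : Strategy N m) (h : Hist N m) (s : State N),
    onward G (zeroSum G i j) (combine G j π' (stationary σ)) h s ≤
      onward G (zeroSum G i j) (stationary σ) h s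

/-- The utility under punishment `u^p(s)`, where `σ i` is the strategy punishing player `i`.  (The
utilities do not depend on the history, as `σ i` does not.) -/
def punUtil {N m : ℕ} (G : Game N m) (σ : Player → State N → Fin m) (s : State N) : ℝ :=
  ⨆ a : Fin m, (G.r (G.ap s) s a +
    ∑ t, G.P s a t * utilDet G (stationary (σ (G.ap s))) (G.ap s) [(s, a)] t)

/-- `μ` is `ε`-feasible: at every admissible history, conditioned on the recommended action, the
onward utility of the acting player is at least the utility under punishment minus `ε`. -/
def Feasible {N m : ℕ} (G : Game N m) (σ : Player → State N → Fin m) (ε : ℝ)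
    (μ : RStrategy N m) : Prop :=
  ∀ (h : Hist N m) (s : State N) (a : Fin m), IsHist (h ++ [(s, a)]) →
    ∀ H : RAdmits μ (h ++ [(s, a)]),
      punUtil G σ s - ε ≤ utilUncond G (cond μ (h ++ [(s, a)]) H) (G.ap s) h s

/-! ### The optimization algorithm

`am` is the rule by which every `argmax` over actions is computed: it maps a list of scores, one for
each action, to an action with the largest score. -/

/-- The point `(-n, -n)`, the value of `p_{s,a}` when no feasible point is found. -/
def noPoint (N : ℕ) : Pt := fun _ => -((N : ℝ) + 1)

/-- What the algorithm stores for a state-action pair: `p_{s,a}`, `ℓ_{s,a}` and `r_{s,a}`. -/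
structure Entry where
  p : Pt
  l : Pt
  r : Pt

/-- The stored entries of all state-action pairs. -/
abbrev Table (N m : ℕ) := State N → Fin m → Entry

/-- `max^k {p, q}`, the point with the larger `k`-th coordinate; an action without a feasible point,
`p = (-n, -n)`, keeps this value. -/
def maxAt {N : ℕ} (k : Player) (p q : Pt) : Pt :=
  if p = noPoint N ∨ q k < p k then p else q

/-- `eval(s, a, α)`, given the entries of the states later than `s`. -/
def eval {N m : ℕ} (G : Game N m) (am : (Fin m → ℝ) → Fin m) (T : Table N m)
    (s : State N) (a : Fin m) (α : Pt) : Pt :=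
  if s = Fin.last N then 0
  else fun i => G.r i s a + ∑ t : State N,
    if _h : s < t then
      let q : Fin m → Pt := fun b => maxAt (N := N) (G.ap t) (T t b).p (eval G am T t b α)
      G.P s a t * q (am fun b => α ⬝ᵥ q b) i
    else 0
termination_by N + 1 - s.val
decreasing_by
  have h₁ : s.val < t.val := _h
  have _ := t.isLt
  omega

/-- The relaxed threshold `u^p(s) - ((n - s - 1) / n) ε`, for the state numbered `s.val + 1`. -/
def relaxed {N m : ℕ} (G : Game N m) (σ : Player → State N → Fin m) (ε : ℝ) (s : State N) : ℝ :=
  punUtil G σ s - (((N : ℝ) + 1) - ((s.val : ℝ) + 1) - 1) / ((N : ℝ) + 1) * ε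

/-- The `ℓ₁` norm. -/
def norm1 (x : Pt) : ℝ := ∑ i, |x i|

/-- One iteration of the binary search over directions, for the acting player `i`, the threshold `c`
and the evaluation `E`. -/
def searchStep (E : Pt → Pt) (i : Player) (c : ℝ) (d : Pt × Pt) : Pt × Pt :=
  let mid : Pt := (1 / 2 : ℝ) • (d.1 + d.2)
  if c ≤ E mid i then (mid, d.2) else (d.1, mid)

/-- The binary search: iterate until the first time the two directions are `tol`-close.  (Each
iteration halves the distance, so such a time exists if `0 < tol`.) -/
def search (E : Pt → Pt) (i : Player) (c tol : ℝ) (d : Pt × Pt) : Pt × Pt :=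
  (searchStep E i c)^[sInf {k : ℕ |
    norm1 (((searchStep E i c)^[k] d).1 - ((searchStep E i c)^[k] d).2) < tol}] d

/-- The entry of a pair with acting player `i`, threshold `c` and evaluation `E`.  When no binary
search is run, both stored directions are the objective direction. -/
def computeEntry (N : ℕ) (E : Pt → Pt) (i : Player) (c ε : ℝ) (αobj : Pt) : Entry :=
  if c ≤ E αobj i then ⟨E αobj, αobj, αobj⟩
  else if E (Pi.single i 1) i < c then ⟨noPoint N, αobj, αobj⟩
  else
    let d := search E i c (ε / (10 * ((N : ℝ) + 1) ^ 2)) (Pi.single i 1, αobj)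
    let ql := E d.1
    let qr := E d.2
    ⟨((ql i - c) / (ql i - qr i)) • qr + ((c - qr i) / (ql i - qr i)) • ql, d.1, d.2⟩

/-- The table after the states `n - 1, …, n - k` have been processed.  The entries of the terminal
state are `p = (0, 0)`. -/
def tableAfter {N m : ℕ} (G : Game N m) (σ : Player → State N → Fin m)
    (am : (Fin m → ℝ) → Fin m) (αobj : Pt) (ε : ℝ) : ℕ → Table N m
  | 0 => fun _ _ => ⟨0, αobj, αobj⟩
  | k + 1 => fun s a =>
      if s.val + (k + 1) = N then
        computeEntry N (eval G am (tableAfter G σ am αobj ε k) s a) (G.ap s)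
          (relaxed G σ ε s) ε αobj
      else tableAfter G σ am αobj ε k s a

/-- The table computed by the algorithm.  The stored evaluations `𝒟(s, a, α)` are the values
`eval G am (table …) s a α`. -/
def table {N m : ℕ} (G : Game N m) (σ : Player → State N → Fin m)
    (am : (Fin m → ℝ) → Fin m) (αobj : Pt) (ε : ℝ) : Table N m :=
  tableAfter G σ am αobj ε N

/-- The objective value `opt` computed by the algorithm. -/
def opt {N m : ℕ} (G : Game N m) (σ : Player → State N → Fin m)
    (am : (Fin m → ℝ) → Fin m) (αobj : Pt) (ε : ℝ) : ℝ :=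
  ⨆ a : Fin m, αobj ⬝ᵥ (table G σ am αobj ε 0 a).p

/-! ### The decoding algorithm

The functions below take the computed table `T`. -/

/-- `max^{ap(s)} {p_{s,a}, 𝒟(s, a, α)}`. -/
def value {N m : ℕ} (G : Game N m) (am : (Fin m → ℝ) → Fin m) (T : Table N m)
    (s : State N) (a : Fin m) (α : Pt) : Pt :=
  maxAt (N := N) (G.ap s) (T s a).p (eval G am T s a α)

/-- `argmax_{a} α · max^{ap(s)} {p_{s,a}, 𝒟(s, a, α)}`. -/
def best {N m : ℕ} (G : Game N m) (am : (Fin m → ℝ) → Fin m) (T : Table N m)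
    (s : State N) (α : Pt) : Fin m :=
  am fun a => α ⬝ᵥ value G am T s a α

/-- A possible internal state of the decoder: the direction `α`, the current point `q`, and the
probability `w` of the random choices of directions leading to it. -/
structure Branch where
  w : ℝ
  α : Pt
  q : Pt

/-- The possible directions, with their probabilities, after the step `(s, a)`.  If `q = p_{s,a}`, the
new direction is `ℓ_{s,a}` with probability `(q_r - q) / (q_r - q_ℓ)` and `r_{s,a}` otherwise, where
`q_ℓ` and `q_r` are the evaluations at `(s, a)` in these directions, so that the mean evaluation is
`q`; the quotient is that of the coordinates of the acting player.  (It is `0` by convention if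
`ℓ_{s,a} = r_{s,a}`, when the choice is immaterial.)  Otherwise the direction is kept. -/
def directions {N m : ℕ} (G : Game N m) (am : (Fin m → ℝ) → Fin m) (T : Table N m)
    (s : State N) (a : Fin m) (b : Branch) : List (ℝ × Pt) :=
  if b.q = (T s a).p then
    let ql := eval G am T s a (T s a).l (G.ap s)
    let qr := eval G am T s a (T s a).r (G.ap s)
    let pl := (qr - b.q (G.ap s)) / (qr - ql)
    [(b.w * pl, (T s a).l), (b.w * (1 - pl), (T s a).r)]
  else [(b.w, b.α)]

/-- The decoder after the step `(s, a)`, with remaining steps `h` and current state `s'`.  Directions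
that do not recommend the next action of the history are discarded.  At the end, the recommended
action is drawn according to the remaining directions; the output is `none` (printed as `-1`) if no
direction of positive probability is left. -/
def decodeFrom {N m : ℕ} (G : Game N m) (am : (Fin m → ℝ) → Fin m) (T : Table N m)
    (s' : State N) : List Branch → State N → Fin m → Hist N m → Option (Fin m → ℝ)
  | bs, s, a, [] =>
      let ds := bs.flatMap (directions G am T s a)
      let total := (ds.map Prod.fst).sum
      if total = 0 then none
      else some fun b =>
        ((ds.filter fun d => decide (best G am T s' d.2 = b)).map Prod.fst).sum / total
  | bs, s, a, (t, b) :: h =>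
      decodeFrom G am T s'
        (((bs.flatMap (directions G am T s a)).filter
            fun d => decide (best G am T t d.2 = b)).map
          fun d => ⟨d.1, d.2, value G am T t b d.2⟩) t b h

/-- The decoding algorithm: the law of the random action that it returns for the history `h` and the
state `s`, or `none` (printed as `-1`). -/
def decode {N m : ℕ} (G : Game N m) (am : (Fin m → ℝ) → Fin m) (T : Table N m) (αobj : Pt) :
    Hist N m → State N → Option (Fin m → ℝ)
  | [], s => some fun b => if b = am (fun a => αobj ⬝ᵥ (T s a).p) then 1 else 0
  | (s₁, a₁) :: h, s =>
      if a₁ = am (fun a => αobj ⬝ᵥ (T s₁ a).p) then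
        decodeFrom G am T s [⟨1, αobj, (T s₁ a₁).p⟩] s₁ a₁ h
      else none

/-- `μ` is a strategy output by the decoder: at each
admissible history `h` and each state `s`, the decoder returns the law of `π(h, s)` for
`π ∼ μ ∣ h`, and at each inadmissible history it returns `none`. -/
def IsDecoded {N m : ℕ} (out : Hist N m → State N → Option (Fin m → ℝ))
    (μ : RStrategy N m) : Prop :=
  ∀ (h : Hist N m) (s : State N), IsHistState h s →
    (∀ H : RAdmits μ h,
      out h s = some fun a => (((cond μ h H).map fun π => π h s) a).toReal) ∧
    (¬ RAdmits μ h → out h s = none)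

end TurnTaking

end

noncomputable section

namespace TurnTaking

variable {N m : ℕ}

/-! ### Evaluations and the computed table -/

/-! After a history ending in the step `(s, a)`, the decoder carries finitely many weighted branches
`(w, α, q)`. For every strategy `μ` output by it, two identities hold. The total weight of the
branches is the probability that `π ∼ μ` admits the history (`toReal_admitProb_eq_weight`). The
weighted sum of the points `q` is the expected utility from `s` on, restricted to the admitting `π`
and not normalized (`expect_reward_eq`). The second identity holds because both sides obey the same
recursion along the game. Splitting a direction into `ℓ` and `r` keeps `q` as the mean evaluation
(`table_splits`, `sum_directions_eval`), and an evaluation is the reward plus the expected value of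
the action recommended next (`weightedSum_eq`, `expect_reward_succ`). At the first step there is one
branch, with point `p`, which gives the value `opt`.

Feasibility is then read off branch by branch: the acting player's coordinate of `q` is at least the
relaxed threshold, provided that no action marked `(-n, -n)` is ever recommended. This proviso is
`stateBound`, proved by backward induction. All unmarked values are nonnegative and, up to the
slack, at least the values under punishment. Hence an action attaining `u^p(s)` passes the test in
direction `e_i`, and its nonnegative score beats the negative score of a marked action.

For existence, the weights of the one-step extensions of a history sum to its own weight. Drawing
the actions at all pairs `(h, s)` independently, with the quotients of weights as probabilities,
produces the required strategy (`IsHistWeight.exists_isDecoded`). -/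

theorem eval_last (G : Game N m) (am : (Fin m → ℝ) → Fin m) (T : Table N m) (a : Fin m) (α : Pt) :
    eval G am T (Fin.last N) a α = 0 := by
  rw [eval]; simp

theorem eval_apply_of_lt (G : Game N m) (am : (Fin m → ℝ) → Fin m) (T : Table N m) {s : State N}
    (hs : s < Fin.last N) (a : Fin m) (α : Pt) (i : Player) :
    eval G am T s a α i = G.r i s a + ∑ t : State N,
      if s < t then G.P s a t * value G am T t (best G am T t α) α i else 0 := by
  rw [eval, if_neg hs.ne]
  simp only [dite_eq_ite]
  rfl

/-- The recursion reads only entries of later states. This allows the table under construction to be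
replaced by the final one in `table_of_lt`. -/
theorem eval_congr (G : Game N m) (am : (Fin m → ℝ) → Fin m) {T T' : Table N m} (s : State N)
    (h : ∀ t, s < t → T t = T' t) : eval G am T s = eval G am T' s := by
  induction s using WellFoundedGT.induction with
  | _ s ih =>
    rcases (Fin.le_last s).eq_or_lt with rfl | hs
    · funext a α; rw [eval_last, eval_last]
    · funext a α i
      rw [eval_apply_of_lt G am T hs, eval_apply_of_lt G am T' hs]
      congr 1
      refine Finset.sum_congr rfl fun t _ => ?_
      split_ifs with hst
      · have hv : value G am T t = value G am T' t := by
          funext b β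
          rw [value, value, h t hst, ih t hst fun u hu => h u (hst.trans hu)]
        have hb : best G am T t = best G am T' t := by
          funext β
          rw [best, best, hv]
        rw [hv, hb]
      · rfl

section table

variable (G : Game N m) (σ : Player → State N → Fin m) (am : (Fin m → ℝ) → Fin m) (αobj : Pt)
  (ε : ℝ)

/-- Stage `k + 1` writes only the state of value `N - (k + 1)`, so an entry is final once that stage
has passed. -/
theorem tableAfter_eq_table {s : State N} {k : ℕ} (hk : N ≤ s.val + k) (hkN : k ≤ N) :
    tableAfter G σ am αobj ε k s = table G σ am αobj ε s := by
  induction hkN using Nat.decreasingInduction with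
  | self => rfl
  | of_succ k _ ih =>
    rw [← ih (by omega)]
    funext a
    simp only [tableAfter]
    rw [if_neg (by omega)]

theorem table_last (a : Fin m) : table G σ am αobj ε (Fin.last N) a = ⟨0, αobj, αobj⟩ := by
  rw [← tableAfter_eq_table G σ am αobj ε (k := 0) (by simp) (Nat.zero_le _)]
  rfl

theorem table_of_lt {s : State N} (hs : s < Fin.last N) (a : Fin m) :
    table G σ am αobj ε s a =
      computeEntry N (eval G am (table G σ am αobj ε) s a) (G.ap s) (relaxed G σ ε s) ε αobj := by
  have hs' : s.val < N := hs
  obtain ⟨k, hk⟩ : ∃ k, s.val + (k + 1) = N := ⟨N - s.val - 1, by omega⟩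
  rw [← tableAfter_eq_table G σ am αobj ε (k := k + 1) (s := s) (by omega) (by omega),
    ← eval_congr G am (T := tableAfter G σ am αobj ε k) s]
  · simp only [tableAfter]
    rw [if_pos hk]
  intro t ht
  have : s.val < t.val := ht
  exact tableAfter_eq_table G σ am αobj ε (by omega) (by omega)

end table

/-! ### Entries of the table -/

/-- A nonnegative, nonzero direction. -/
def IsDir (α : Pt) : Prop := (∀ i, 0 ≤ α i) ∧ ∃ i, 0 < α i

theorem isDir_single (i : Player) : IsDir (Pi.single i 1) := by
  refine ⟨fun j => ?_, i, by simp⟩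
  by_cases h : j = i
  · subst h; simp
  · simp [h]

theorem IsDir.midpoint {α β : Pt} (hα : IsDir α) (hβ : IsDir β) :
    IsDir ((1 / 2 : ℝ) • (α + β)) := by
  obtain ⟨hα, i, hi⟩ := hα
  have key : ∀ j, ((1 / 2 : ℝ) • (α + β)) j = (1 / 2) * (α j + β j) := fun j => by simp
  refine ⟨fun j => ?_, i, ?_⟩
  · rw [key]; linarith [hα j, hβ.1 j]
  · rw [key]; linarith [hβ.1 i]

theorem IsDir.dotProduct_nonneg {α q : Pt} (hα : IsDir α) (hq : ∀ i, 0 ≤ q i) : 0 ≤ α ⬝ᵥ q :=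
  Finset.sum_nonneg fun i _ => mul_nonneg (hα.1 i) (hq i)

theorem IsDir.dotProduct_noPoint_neg {α : Pt} (hα : IsDir α) (N : ℕ) : α ⬝ᵥ noPoint N < 0 := by
  obtain ⟨h, i, hi⟩ := hα
  have hn : -((N : ℝ) + 1) < 0 := by
    have : (0 : ℝ) ≤ N := N.cast_nonneg
    linarith
  refine Finset.sum_neg' (fun j _ => ?_) ⟨i, Finset.mem_univ _, ?_⟩
  · exact mul_nonpos_of_nonneg_of_nonpos (h j) hn.le
  · exact mul_neg_of_pos_of_neg hi hn

theorem noPoint_neg (N : ℕ) (i : Player) : noPoint N i < 0 := by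
  have : (0 : ℝ) ≤ N := N.cast_nonneg
  simp only [noPoint]
  linarith

/-- The probability with which the decoder moves from the point `p` of the entry `e` to the left
direction, for the acting player `i` and the evaluation `E`. -/
def leftProb (E : Pt → Pt) (i : Player) (e : Entry) : ℝ :=
  (E e.r i - e.p i) / (E e.r i - E e.l i)

/-- The point of the entry `e` is the mean of the evaluations in its two directions. -/
structure Splits (E : Pt → Pt) (i : Player) (e : Entry) : Prop where
  nonneg : 0 ≤ leftProb E i e
  le_one : leftProb E i e ≤ 1
  eq : e.p = leftProb E i e • E e.l + (1 - leftProb E i e) • E e.r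

/-- Here `leftProb` is `0 / 0 = 0`, so all mass goes to the right direction. -/
theorem splits_of_eq (E : Pt → Pt) (i : Player) (α : Pt) : Splits E i ⟨E α, α, α⟩ := by
  constructor <;> simp [leftProb]

/-- The threshold stays crossed between the two directions. Each single step preserves this, so it
holds at every iterate, whatever the stopping time. -/
theorem search_invariant (E : Pt → Pt) (i : Player) (c tol : ℝ) (d : Pt × Pt)
    (h₁ : IsDir d.1) (h₂ : IsDir d.2) (h₃ : c ≤ E d.1 i) (h₄ : E d.2 i < c) :
    IsDir (search E i c tol d).1 ∧ IsDir (search E i c tol d).2 ∧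
      c ≤ E (search E i c tol d).1 i ∧ E (search E i c tol d).2 i < c := by
  refine Function.Iterate.rec
    (fun d : Pt × Pt => IsDir d.1 ∧ IsDir d.2 ∧ c ≤ E d.1 i ∧ E d.2 i < c) ⟨h₁, h₂, h₃, h₄⟩
    (f := searchStep E i c) ?_ _
  rintro d ⟨h₁, h₂, h₃, h₄⟩
  rw [searchStep]
  split_ifs with h
  · exact ⟨h₁.midpoint h₂, h₂, h, h₄⟩
  · exact ⟨h₁, h₁.midpoint h₂, h₃, not_le.mp h⟩

/-- The marker arises only when even direction `e_i` misses the threshold. Otherwise `p` is an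
evaluation, or the point with `i`-th coordinate `c` on the segment from `q_r` to `q_ℓ`; it is an
exact mean in both coordinates, although `leftProb` looks at only one. -/
theorem computeEntry_spec (N : ℕ) (E : Pt → Pt) (i : Player) (c ε : ℝ) {αobj : Pt}
    (hα : IsDir αobj) :
    IsDir (computeEntry N E i c ε αobj).l ∧ IsDir (computeEntry N E i c ε αobj).r ∧
      (((computeEntry N E i c ε αobj).p = noPoint N ∧ E (Pi.single i 1) i < c) ∨
        (c ≤ (computeEntry N E i c ε αobj).p i ∧ Splits E i (computeEntry N E i c ε αobj))) := by
  rw [computeEntry]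
  split_ifs with h₁ h₂
  · exact ⟨hα, hα, Or.inr ⟨h₁, splits_of_eq E i αobj⟩⟩
  · exact ⟨hα, hα, Or.inl ⟨rfl, h₂⟩⟩
  · obtain ⟨hl, hr, hcl, hcr⟩ := search_invariant E i c (ε / (10 * ((N : ℝ) + 1) ^ 2))
      (Pi.single i 1, αobj) (isDir_single i) hα (not_lt.mp h₂) (not_le.mp h₁)
    dsimp only
    set d := search E i c (ε / (10 * ((N : ℝ) + 1) ^ 2)) (Pi.single i 1, αobj)
    have hpos : 0 < E d.1 i - E d.2 i := by linarith
    -- Since the `i`-th coordinate of `p` is exactly `c`, the quotient `leftProb` recovers the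
    -- coefficient of `q_ℓ`.
    have hp : ((((E d.1 i - c) / (E d.1 i - E d.2 i)) • E d.2 +
        ((c - E d.2 i) / (E d.1 i - E d.2 i)) • E d.1 : Pt)) i = c := by
      simp only [Pi.add_apply, Pi.smul_apply, smul_eq_mul]
      field_simp
      ring
    have hleft : leftProb E i ⟨((E d.1 i - c) / (E d.1 i - E d.2 i)) • E d.2 +
        ((c - E d.2 i) / (E d.1 i - E d.2 i)) • E d.1, d.1, d.2⟩ =
          (c - E d.2 i) / (E d.1 i - E d.2 i) := by
      rw [leftProb]
      dsimp only
      rw [hp, ← neg_div_neg_eq, neg_sub, neg_sub]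
    refine ⟨hl, hr, Or.inr ⟨hp.ge, ?_, ?_, ?_⟩⟩ <;> rw [hleft]
    · exact div_nonneg (by linarith) hpos.le
    · rw [div_le_one hpos]; linarith
    · have h1 : 1 - (c - E d.2 i) / (E d.1 i - E d.2 i) =
          (E d.1 i - c) / (E d.1 i - E d.2 i) := by
        field_simp
        ring
      rw [h1, add_comm]

/-! ### Transitions, rewards and punishment -/

theorem Game.P_eq_zero (G : Game N m) {s t : State N} (h : ¬ Later s t) (a : Fin m) :
    G.P s a t = 0 :=
  le_antisymm (not_lt.mp fun hp => h (G.acyclic s a t hp)) (G.P_nonneg s a t)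

theorem Game.P_last_eq_zero (G : Game N m) {t : State N} (ht : t ≠ Fin.last N) (a : Fin m) :
    G.P (Fin.last N) a t = 0 := by
  refine G.P_eq_zero ?_ a
  rintro (h | h)
  · exact absurd h (not_lt.mpr (Fin.le_last t))
  · exact ht h.2

theorem Game.P_eq_zero_of_lt (G : Game N m) {s t : State N} (hs : s < Fin.last N) (h : ¬ s < t)
    (a : Fin m) : G.P s a t = 0 :=
  G.P_eq_zero (by rintro (h' | h'); exacts [h h', hs.ne h'.1]) a

theorem reward_last (G : Game N m) {ρ : State N → Fin m → ℝ} (hρ : ∀ a, ρ (Fin.last N) a = 0)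
    (π : Strategy N m) (k : ℕ) (h : Hist N m) : reward G ρ π k h (Fin.last N) = 0 := by
  induction k generalizing h with
  | zero => rfl
  | succ k ih =>
    rw [reward, hρ, zero_add]
    refine Finset.sum_eq_zero fun t _ => ?_
    by_cases ht : t = Fin.last N
    · rw [ht, ih, mul_zero]
    · rw [G.P_last_eq_zero ht, zero_mul]

/-- At most `N - s` moves lead from `s` to the terminal state, where nothing more is earned; a
longer horizon adds nothing. -/
theorem reward_succ_of_le (G : Game N m) {ρ : State N → Fin m → ℝ}
    (hρ : ∀ a, ρ (Fin.last N) a = 0) (π : Strategy N m) {k : ℕ} (h : Hist N m) {s : State N}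
    (hk : N ≤ s.val + k) : reward G ρ π (k + 1) h s = reward G ρ π k h s := by
  rcases (Fin.le_last s).eq_or_lt with rfl | hs
  · rw [reward_last G hρ, reward_last G hρ]
  induction k generalizing h s with
  | zero => exact absurd hk (by have : s.val < N := hs; omega)
  | succ k ih =>
    rw [reward, reward]
    congr 1
    refine Finset.sum_congr rfl fun t _ => ?_
    by_cases hst : s < t
    · have : s.val < t.val := hst
      rcases (Fin.le_last t).eq_or_lt with rfl | ht
      · rw [reward_last G hρ, reward_last G hρ]
      · rw [ih _ (by omega) ht]
    · rw [G.P_eq_zero_of_lt hs hst, zero_mul, zero_mul]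

theorem reward_stationary (G : Game N m) (ρ : State N → Fin m → ℝ) (σ : State N → Fin m) (k : ℕ)
    (h h' : Hist N m) (s : State N) :
    reward G ρ (stationary σ) k h s = reward G ρ (stationary σ) k h' s := by
  induction k generalizing h h' s with
  | zero => rfl
  | succ k ih =>
    rw [reward, reward]
    congr 1
    exact Finset.sum_congr rfl fun t _ => by rw [ih _ (h' ++ [(s, stationary σ h' s)])]; rfl

theorem reward_neg (G : Game N m) (ρ : State N → Fin m → ℝ) (π : Strategy N m) (k : ℕ)
    (h : Hist N m) (s : State N) :
    reward G (fun s a => -ρ s a) π k h s = -reward G ρ π k h s := by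
  induction k generalizing h s with
  | zero => simp [reward]
  | succ k ih => simp only [reward, ih, mul_neg, Finset.sum_neg_distrib, neg_add]

theorem reward_congr_of_ne_nil (G : Game N m) (ρ : State N → Fin m → ℝ) {π π' : Strategy N m}
    (hπ : ∀ h s, h ≠ [] → π h s = π' h s) (k : ℕ) {h : Hist N m} (hh : h ≠ []) (s : State N) :
    reward G ρ π k h s = reward G ρ π' k h s := by
  induction k generalizing h s with
  | zero => rfl
  | succ k ih =>
    rw [reward, reward, hπ h s hh]
    congr 1
    exact Finset.sum_congr rfl fun t _ => by rw [ih (by simp)]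

/-- The utility of player `i` from state `s` on when player `i` is punished by `σ i`. -/
def punValue (G : Game N m) (σ : Player → State N → Fin m) (i : Player) (s : State N) : ℝ :=
  utilDet G (stationary (σ i)) i [] s

section punishment

variable (G : Game N m) (σ : Player → State N → Fin m)

theorem utilDet_stationary_eq_punValue (i : Player) (h : Hist N m) (s : State N) :
    utilDet G (stationary (σ i)) i h s = punValue G σ i s :=
  reward_stationary _ _ _ _ _ _ _

theorem punValue_last (i : Player) : punValue G σ i (Fin.last N) = 0 :=
  reward_last G (G.term_r i) _ _ _

/-- After one of the `N + 1` steps only `N` remain; they suffice for the full value, which closes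
the Bellman equation `punValue_eq`. -/
theorem reward_eq_punValue (i : Player) (h : Hist N m) (s : State N) :
    reward G (G.r i) (stationary (σ i)) N h s = punValue G σ i s := by
  rw [reward_stationary G _ _ _ h [], ← reward_succ_of_le G (G.term_r i) _ _ (by omega)]
  rfl

theorem punValue_eq (i : Player) (s : State N) :
    punValue G σ i s = G.r i s (σ i s) + ∑ t, G.P s (σ i s) t * punValue G σ i t := by
  rw [punValue, utilDet, onward, reward]
  simp only [reward_eq_punValue]
  rfl

theorem le_punUtil (s : State N) (a : Fin m) :
    G.r (G.ap s) s a + ∑ t, G.P s a t * punValue G σ (G.ap s) t ≤ punUtil G σ s := by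
  simp only [punUtil, utilDet_stationary_eq_punValue]
  exact le_ciSup (f := fun a => G.r (G.ap s) s a + ∑ t, G.P s a t * punValue G σ (G.ap s) t)
    (Set.finite_range _).bddAbove a

theorem exists_eq_punUtil [NeZero m] (s : State N) :
    ∃ a, punUtil G σ s = G.r (G.ap s) s a + ∑ t, G.P s a t * punValue G σ (G.ap s) t := by
  simp only [punUtil, utilDet_stationary_eq_punValue]
  obtain ⟨a, ha⟩ := exists_eq_ciSup_of_finite
    (f := fun a => G.r (G.ap s) s a + ∑ t, G.P s a t * punValue G σ (G.ap s) t)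
  exact ⟨a, ha.symm⟩

theorem punValue_le_punUtil (s : State N) : punValue G σ (G.ap s) s ≤ punUtil G σ s := by
  rw [punValue_eq]
  exact le_punUtil G σ s _

theorem punUtil_last [NeZero m] : punUtil G σ (Fin.last N) = 0 := by
  obtain ⟨a, ha⟩ := exists_eq_punUtil G σ (Fin.last N)
  rw [ha, G.term_r, zero_add]
  refine Finset.sum_eq_zero fun t _ => ?_
  by_cases ht : t = Fin.last N
  · rw [ht, punValue_last, mul_zero]
  · rw [G.P_last_eq_zero ht, zero_mul]

variable {σ}

/-- One-shot deviation: at a state of the opponent, who minimizes the utility of `i`, playing `b`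
once and then returning to `σ i` cannot lower that utility. At states of `i` itself, the maximum in
`punUtil` is enough. -/
theorem punValue_le (i : Player) (hσ : IsPunishment G i (σ i)) {s : State N} (hs : G.ap s ≠ i)
    (b : Fin m) : punValue G σ i s ≤ G.r i s b + ∑ t, G.P s b t * punValue G σ i t := by
  have hz : zeroSum G i (G.ap s) = fun s a => -G.r i s a := by
    funext s' a
    simp [zeroSum, hs]
  -- Equilibrium is applied at the empty history, so the deviation is visible only in the first
  -- step.
  set π' : Strategy N m := fun h s => if h = [] then b else σ i s
  have key := hσ (G.ap s) π' [] s
  rw [hz, onward, onward, reward_neg, reward_neg, neg_le_neg_iff] at key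
  refine key.trans_eq ?_
  have h0 : combine G (G.ap s) π' (stationary (σ i)) [] s = b := by simp [combine, π']
  rw [reward, h0]
  congr 1
  refine Finset.sum_congr rfl fun t _ => ?_
  rw [reward_congr_of_ne_nil G _ (π' := stationary (σ i)) _ _ (by simp), reward_eq_punValue]
  intro h s' hh
  simp [combine, π', hh, stationary]

end punishment

/-! ### Feasible actions and lower bounds for the computed points -/

theorem maxAt_eq_or {N : ℕ} (k : Player) (p q : Pt) :
    maxAt (N := N) k p q = p ∨ maxAt (N := N) k p q = q := by
  rw [maxAt]; split_ifs <;> simp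

theorem le_maxAt {N : ℕ} (k : Player) (p q : Pt) : p k ≤ maxAt (N := N) k p q k := by
  rw [maxAt]
  split_ifs with h
  · exact le_rfl
  · exact not_lt.mp fun h' => h (Or.inr h')

/-- The slack in the threshold of the state `s`; it is `0` at the last two states. -/
def slack (N : ℕ) (ε : ℝ) (s : State N) : ℝ :=
  max 0 (((N : ℝ) - s.val - 1) / ((N : ℝ) + 1)) * ε

theorem slack_anti {ε : ℝ} (hε : 0 < ε) {s t : State N} (h : s < t) :
    slack N ε t ≤ slack N ε s := by
  have : (s.val : ℝ) ≤ t.val := by exact_mod_cast (show s.val < t.val from h).le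
  unfold slack
  gcongr

theorem slack_nonneg {ε : ℝ} (hε : 0 < ε) (s : State N) : 0 ≤ slack N ε s :=
  mul_nonneg (le_max_left _ _) hε.le

theorem slack_le {ε : ℝ} (hε : 0 < ε) (s : State N) : slack N ε s ≤ ε := by
  refine mul_le_of_le_one_left hε.le (max_le zero_le_one ?_)
  have : (0 : ℝ) ≤ s.val := Nat.cast_nonneg _
  have : (0 : ℝ) ≤ N := Nat.cast_nonneg _
  rw [div_le_one (by linarith)]
  linarith

theorem relaxed_eq (G : Game N m) (σ : Player → State N → Fin m) (ε : ℝ) {s : State N}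
    (hs : s < Fin.last N) : relaxed G σ ε s = punUtil G σ s - slack N ε s := by
  have h : (s.val : ℝ) + 1 ≤ N := by exact_mod_cast (show s.val < N from hs)
  rw [relaxed, slack, max_eq_right (div_nonneg (by linarith) (by positivity))]
  ring_nf

section bounds

variable (G : Game N m) {σ : Player → State N → Fin m}
  (hσ : ∀ i, IsPunishment G i (σ i)) {am : (Fin m → ℝ) → Fin m}
  (ham : ∀ (f : Fin m → ℝ) (a : Fin m), f a ≤ f (am f)) {αobj : Pt} (hα : IsDir αobj)
  {ε : ℝ} (hε : 0 < ε)

/-- At the state `s`, some action has a feasible point, and the values of all such actions are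
nonnegative and at least the values under punishment, up to the slack. -/
def StateBound (G : Game N m) (σ : Player → State N → Fin m) (am : (Fin m → ℝ) → Fin m)
    (T : Table N m) (ε : ℝ) (s : State N) : Prop :=
  (∃ a, (T s a).p ≠ noPoint N) ∧
  ∀ a α, IsDir α → (T s a).p ≠ noPoint N → ∀ q, (q = (T s a).p ∨ q = value G am T s a α) →
    ∀ i, 0 ≤ q i ∧ punValue G σ i s - slack N ε s ≤ q i

include ham in
-- A marked action keeps the value `(-n, -n)`, whose score is negative in every nonnegative nonzero
-- direction, while some unmarked action has a nonnegative score.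
theorem StateBound.best_ne {G : Game N m} {T : Table N m} {s : State N}
    (H : StateBound G σ am T ε s) {α : Pt} (hα : IsDir α) :
    (T s (best G am T s α)).p ≠ noPoint N := by
  intro hb
  obtain ⟨a, ha⟩ := H.1
  have h₁ := ham (fun a => α ⬝ᵥ value G am T s a α) a
  have h₂ : value G am T s (best G am T s α) α = noPoint N := by
    rw [value, maxAt, if_pos (Or.inl hb), hb]
  change _ ≤ α ⬝ᵥ value G am T s (best G am T s α) α at h₁
  rw [h₂] at h₁
  exact absurd (hα.dotProduct_noPoint_neg N)
    (not_lt.mpr ((hα.dotProduct_nonneg fun i => (H.2 a α hα ha _ (Or.inr rfl) i).1).trans h₁))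

include ham hε in
-- The slack does not increase along transitions, so the average slack of the successors is at most
-- that of `s`.
theorem eval_bound {G : Game N m} {T : Table N m} {s : State N} (hs : s < Fin.last N)
    (H : ∀ t, s < t → StateBound G σ am T ε t) {α : Pt} (hα : IsDir α) (a : Fin m) (i : Player) :
    0 ≤ eval G am T s a α i ∧
      G.r i s a + ∑ t, G.P s a t * punValue G σ i t - slack N ε s ≤ eval G am T s a α i := by
  have hb : ∀ t, s < t → 0 ≤ value G am T t (best G am T t α) α i ∧
      punValue G σ i t - slack N ε t ≤ value G am T t (best G am T t α) α i := fun t ht =>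
    (H t ht).2 _ α hα ((H t ht).best_ne ham hα) _ (Or.inr rfl) i
  rw [eval_apply_of_lt G am T hs]
  constructor
  · refine add_nonneg (G.r_nonneg i s a) (Finset.sum_nonneg fun t _ => ?_)
    split_ifs with ht
    · exact mul_nonneg (G.P_nonneg s a t) (hb t ht).1
    · exact le_rfl
  · rw [add_sub_assoc]
    refine add_le_add le_rfl ?_
    have hsum : slack N ε s = ∑ t, G.P s a t * slack N ε s := by
      rw [← Finset.sum_mul, G.P_sum, one_mul]
    rw [hsum, ← Finset.sum_sub_distrib]
    refine Finset.sum_le_sum fun t _ => ?_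
    split_ifs with ht
    · rw [← mul_sub]
      refine mul_le_mul_of_nonneg_left ?_ (G.P_nonneg s a t)
      linarith [(hb t ht).2, slack_anti hε ht]
    · rw [G.P_eq_zero_of_lt hs ht]
      simp

include hα in
theorem table_spec {s : State N} (hs : s < Fin.last N) (a : Fin m) :
    IsDir (table G σ am αobj ε s a).l ∧ IsDir (table G σ am αobj ε s a).r ∧
      (((table G σ am αobj ε s a).p = noPoint N ∧
        eval G am (table G σ am αobj ε) s a (Pi.single (G.ap s) 1) (G.ap s) < relaxed G σ ε s) ∨
      (relaxed G σ ε s ≤ (table G σ am αobj ε s a).p (G.ap s) ∧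
        Splits (eval G am (table G σ am αobj ε) s a) (G.ap s) (table G σ am αobj ε s a))) := by
  have h := computeEntry_spec N (eval G am (table G σ am αobj ε) s a) (G.ap s)
    (relaxed G σ ε s) ε hα
  rwa [← table_of_lt G σ am αobj ε hs a] at h

include hα in
theorem table_dirs (s : State N) (a : Fin m) :
    IsDir (table G σ am αobj ε s a).l ∧ IsDir (table G σ am αobj ε s a).r := by
  rcases (Fin.le_last s).eq_or_lt with rfl | hs
  · rw [table_last]; exact ⟨hα, hα⟩
  · have h := table_spec G (σ := σ) (am := am) hα (ε := ε) hs a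
    exact ⟨h.1, h.2.1⟩

include hα in
theorem table_splits {s : State N} {a : Fin m} (h : (table G σ am αobj ε s a).p ≠ noPoint N) :
    Splits (eval G am (table G σ am αobj ε) s a) (G.ap s) (table G σ am αobj ε s a) := by
  rcases (Fin.le_last s).eq_or_lt with rfl | hs
  · have h0 := splits_of_eq (eval G am (table G σ am αobj ε) (Fin.last N) a) (G.ap (Fin.last N))
      αobj
    rwa [eval_last, ← table_last G σ am αobj ε a] at h0
  · rcases (table_spec G hα hs a).2.2 with h' | h'
    · exact absurd h'.1 h
    · exact h'.2

include hσ ham hα hε in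
-- Backward induction. For the acting player the bound comes from the threshold; for the other
-- player it comes from `eval_bound` and `punValue_le`, since no action of the opponent takes that
-- player below the punishment value.
theorem stateBound [NeZero m] (s : State N) : StateBound G σ am (table G σ am αobj ε) ε s := by
  induction s using WellFoundedGT.induction with
  | _ s ih =>
    set T := table G σ am αobj ε with hT
    rcases (Fin.le_last s).eq_or_lt with rfl | hs
    · have hp : ∀ a, (T (Fin.last N) a).p = 0 := fun a => by rw [hT, table_last]
      refine ⟨⟨0, ?_⟩, ?_⟩
      · rw [hp]
        exact fun h => absurd (congrFun h 0) (noPoint_neg N 0).ne'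
      · intro a α _ _ q hq i
        have : q = 0 := by
          rcases hq with rfl | rfl
          · exact hp a
          · rw [value, eval_last, hp]
            exact (maxAt_eq_or _ _ _).elim id id
        rw [this, punValue_last]
        have := slack_nonneg hε (Fin.last N)
        refine ⟨le_rfl, ?_⟩
        simpa using this
    · have hE := fun {α} (hα : IsDir α) a i => eval_bound ham hε hs ih hα a i
      refine ⟨?_, ?_⟩
      -- For an action attaining `u^p(s)`, the lower bound of `eval_bound` is exactly the relaxed
      -- threshold, so the test in direction `e_i` succeeds.
      · obtain ⟨a, ha⟩ := exists_eq_punUtil G σ s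
        refine ⟨a, ?_⟩
        rcases (table_spec G hα (am := am) (σ := σ) (ε := ε) hs a).2.2 with ⟨_, h⟩ | ⟨_, h⟩
        · rw [relaxed_eq G σ ε hs, ha] at h
          exact absurd h (not_lt.mpr (hE (isDir_single _) a _).2)
        -- A computed point could a priori coincide with the marker; being a mean of nonnegative
        -- evaluations, it does not.
        · intro hp
          rw [← hT] at h
          have hd := table_dirs G hα (am := am) (σ := σ) (ε := ε) s a
          have h1 := congrFun h.eq 0
          rw [hp] at h1
          simp only [Pi.add_apply, Pi.smul_apply, smul_eq_mul] at h1
          have h2 := mul_nonneg h.nonneg (hE hd.1 a 0).1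
          have h3 := mul_nonneg (sub_nonneg.mpr h.le_one) (hE hd.2 a 0).1
          have h4 := noPoint_neg N 0
          linarith
      · intro a α hα' ha q hq i
        have hd := table_dirs G hα (am := am) (σ := σ) (ε := ε) s a
        have hsp := table_splits G hα ha
        have hpb : 0 ≤ (T s a).p i ∧
            G.r i s a + ∑ t, G.P s a t * punValue G σ i t - slack N ε s ≤ (T s a).p i := by
          have h1 := congrFun hsp.eq i
          rw [← hT] at h1
          simp only [Pi.add_apply, Pi.smul_apply, smul_eq_mul] at h1
          rw [h1]
          have hl := hE hd.1 a i
          have hr := hE hd.2 a i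
          have h2 := sub_nonneg.mpr hsp.le_one
          refine ⟨add_nonneg (mul_nonneg hsp.nonneg hl.1) (mul_nonneg h2 hr.1), ?_⟩
          have h3 := mul_le_mul_of_nonneg_left hl.2 hsp.nonneg
          have h4 := mul_le_mul_of_nonneg_left hr.2 h2
          linarith
        have hqb : 0 ≤ q i ∧
            G.r i s a + ∑ t, G.P s a t * punValue G σ i t - slack N ε s ≤ q i := by
          rcases hq with rfl | rfl
          · exact hpb
          · rcases maxAt_eq_or (N := N) (G.ap s) (T s a).p (eval G am T s a α) with h | h <;>
              rw [value, h]
            exacts [hpb, hE hα' a i]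
        refine ⟨hqb.1, ?_⟩
        by_cases hi : G.ap s = i
        · subst hi
          have h1 : relaxed G σ ε s ≤ (T s a).p (G.ap s) := by
            rcases (table_spec G hα (am := am) (σ := σ) (ε := ε) hs a).2.2 with h | h
            exacts [absurd h.1 ha, h.1]
          have h2 : (T s a).p (G.ap s) ≤ q (G.ap s) := by
            rcases hq with rfl | rfl
            exacts [le_rfl, le_maxAt _ _ _]
          rw [relaxed_eq G σ ε hs] at h1
          linarith [punValue_le_punUtil G σ s]
        · linarith [hqb.2, punValue_le G i (hσ i) hi a]

include hσ ham hα hε in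
theorem punUtil_sub_le [NeZero m] {s : State N} {a : Fin m} {α : Pt} (hα' : IsDir α)
    (ha : (table G σ am αobj ε s a).p ≠ noPoint N) {q : Pt}
    (hq : q = (table G σ am αobj ε s a).p ∨ q = value G am (table G σ am αobj ε) s a α) :
    punUtil G σ s - ε ≤ q (G.ap s) := by
  rcases (Fin.le_last s).eq_or_lt with rfl | hs
  · rw [punUtil_last]
    linarith [((stateBound G hσ ham hα hε (Fin.last N)).2 a α hα' ha q hq (G.ap (Fin.last N))).1]
  · have h1 : relaxed G σ ε s ≤ (table G σ am αobj ε s a).p (G.ap s) := by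
      rcases (table_spec G hα (am := am) (σ := σ) (ε := ε) hs a).2.2 with h | h
      exacts [absurd h.1 ha, h.1]
    have h2 : (table G σ am αobj ε s a).p (G.ap s) ≤ q (G.ap s) := by
      rcases hq with rfl | rfl
      exacts [le_rfl, le_maxAt _ _ _]
    rw [relaxed_eq G σ ε hs] at h1
    linarith [slack_le hε s]

end bounds

/-! ### Sums over lists -/

theorem list_sum_flatMap {β γ M : Type*} [AddCommMonoid M] (l : List β) (f : β → List γ)
    (g : γ → M) :
    ((l.flatMap f).map g).sum = (l.map fun b => ((f b).map g).sum).sum := by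
  induction l with
  | nil => rfl
  | cons b l ih => simp [ih]

theorem list_sum_fiber {β M : Type*} [AddCommMonoid M] (l : List β) (f : β → Fin m) (g : β → M) :
    ∑ b, ((l.filter fun d => decide (f d = b)).map g).sum = (l.map g).sum := by
  induction l with
  | nil => simp
  | cons d l ih =>
    have h : ∀ b, (((d :: l).filter fun d => decide (f d = b)).map g).sum =
        (if f d = b then g d else 0) + ((l.filter fun d => decide (f d = b)).map g).sum := by
      intro b
      by_cases hb : f d = b <;> simp [hb]
    simp only [h, Finset.sum_add_distrib, ih]
    simp

/-! ### Branches of the decoder -/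

section branches

variable (G : Game N m) (am : (Fin m → ℝ) → Fin m) (T : Table N m) (αobj : Pt)

/-- The possible directions after the step `(s, a)`, for a list of branches. -/
def dirs (s : State N) (a : Fin m) (bs : List Branch) : List (ℝ × Pt) :=
  bs.flatMap (directions G am T s a)

/-- The branches at the step `(t, b)` that follow the branches `bs` at the step `(s, a)`. -/
def nextBranches (s : State N) (a : Fin m) (bs : List Branch) (t : State N) (b : Fin m) :
    List Branch :=
  ((dirs G am T s a bs).filter fun d => decide (best G am T t d.2 = b)).map
    fun d => ⟨d.1, d.2, value G am T t b d.2⟩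

/-- The branches at the last step of the history `h` that continues the step `(s, a)`. -/
def branchesFrom : List Branch → State N → Fin m → Hist N m → List Branch
  | bs, _, _, [] => bs
  | bs, s, a, (t, b) :: h => branchesFrom (nextBranches G am T s a bs t b) t b h

/-- The branches of the decoder at the last step of a history. -/
def branches : Hist N m → List Branch
  | [] => []
  | (s, a) :: h =>
      if a = am (fun a => αobj ⬝ᵥ (T s a).p) then
        branchesFrom G am T [⟨1, αobj, (T s a).p⟩] s a h
      else []

/-- The total weight of a list of branches. -/
def weight (bs : List Branch) : ℝ := (bs.map Branch.w).sum

/-- The weighted sum of the points of a list of branches, in coordinate `i`. -/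
def weightedSum (i : Player) (bs : List Branch) : ℝ := (bs.map fun b => b.w * b.q i).sum

/-- The probability that the decoder follows a history. -/
def histWeight (h : Hist N m) : ℝ :=
  if h = [] then 1 else weight (branches G am T αobj h)

theorem branchesFrom_append (bs : List Branch) (s₀ : State N) (a₀ : Fin m) (h : Hist N m)
    (s : State N) (a : Fin m) (t : State N) (b : Fin m) :
    branchesFrom G am T bs s₀ a₀ (h ++ [(s, a)] ++ [(t, b)]) =
      nextBranches G am T s a (branchesFrom G am T bs s₀ a₀ (h ++ [(s, a)])) t b := by
  induction h generalizing bs s₀ a₀ with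
  | nil => rfl
  | cons x h ih => exact ih _ _ _

/-- The decoder reads a history from its front, whereas the inductions below extend it at its end.
-/
theorem branches_append (h : Hist N m) (s : State N) (a : Fin m) (t : State N) (b : Fin m) :
    branches G am T αobj (h ++ [(s, a)] ++ [(t, b)]) =
      nextBranches G am T s a (branches G am T αobj (h ++ [(s, a)])) t b := by
  rcases h with _ | ⟨⟨s₀, a₀⟩, h⟩
  · simp only [List.nil_append, List.cons_append, branches]
    split_ifs <;> rfl
  · simp only [List.cons_append, branches]
    split_ifs
    · exact branchesFrom_append G am T _ _ _ _ _ _ _ _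
    · rfl

theorem branches_singleton (s : State N) (a : Fin m) :
    branches G am T αobj [(s, a)] =
      if a = am (fun a => αobj ⬝ᵥ (T s a).p) then [⟨1, αobj, (T s a).p⟩] else [] := rfl

theorem decodeFrom_append (s' : State N) (bs : List Branch) (s₀ : State N) (a₀ : Fin m)
    (h : Hist N m) (s : State N) (a : Fin m) :
    decodeFrom G am T s' bs s₀ a₀ (h ++ [(s, a)]) =
      decodeFrom G am T s' (branchesFrom G am T bs s₀ a₀ (h ++ [(s, a)])) s a [] := by
  induction h generalizing bs s₀ a₀ with
  | nil => rfl
  | cons x h ih => exact ih _ _ _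

theorem decode_append (h : Hist N m) (s : State N) (a : Fin m) (s' : State N) :
    decode G am T αobj (h ++ [(s, a)]) s' =
      decodeFrom G am T s' (branches G am T αobj (h ++ [(s, a)])) s a [] := by
  rcases h with _ | ⟨⟨s₀, a₀⟩, h⟩
  · simp only [List.nil_append, branches, decode]
    split_ifs
    · rfl
    · simp [decodeFrom]
  · simp only [List.cons_append, branches, decode]
    split_ifs
    · exact decodeFrom_append G am T s' _ _ _ _ _ _
    · simp [decodeFrom]

/-- The two splitting weights are `w * pl` and `w * (1 - pl)`, so mass is conserved whatever the
value of `pl`. -/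
theorem sum_dirs_fst (s : State N) (a : Fin m) (bs : List Branch) :
    ((dirs G am T s a bs).map Prod.fst).sum = weight bs := by
  rw [dirs, list_sum_flatMap, weight]
  congr 1
  refine List.map_congr_left fun b _ => ?_
  rw [directions]
  split_ifs
  · simp only [List.map_cons, List.map_nil, List.sum_cons, List.sum_nil]
    ring
  · simp

theorem weight_nextBranches (s : State N) (a : Fin m) (bs : List Branch) (t : State N)
    (b : Fin m) : weight (nextBranches G am T s a bs t b) =
      (((dirs G am T s a bs).filter fun d => decide (best G am T t d.2 = b)).map
        Prod.fst).sum := by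
  rw [weight, nextBranches, List.map_map]
  rfl

theorem histWeight_nil : histWeight G am T αobj [] = 1 := if_pos rfl

theorem histWeight_append (h : Hist N m) (s : State N) (a : Fin m) :
    histWeight G am T αobj (h ++ [(s, a)]) = weight (branches G am T αobj (h ++ [(s, a)])) :=
  if_neg (by simp)

theorem histWeight_singleton (s : State N) (a : Fin m) :
    histWeight G am T αobj [(s, a)] =
      if a = am (fun a => αobj ⬝ᵥ (T s a).p) then 1 else 0 := by
  rw [← List.nil_append [(s, a)], histWeight_append, List.nil_append, branches_singleton]
  split_ifs <;> simp [weight]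

/-- Each direction recommends exactly one action in `s`, so the extensions partition the directions.
-/
theorem sum_histWeight_append (h : Hist N m) (s : State N) :
    ∑ b, histWeight G am T αobj (h ++ [(s, b)]) = histWeight G am T αobj h := by
  rcases h.eq_nil_or_concat' with rfl | ⟨h, ⟨s₀, a₀⟩, rfl⟩
  · simp [histWeight_singleton, histWeight_nil]
  · simp only [histWeight_append, branches_append, weight_nextBranches]
    rw [list_sum_fiber, sum_dirs_fst]

theorem decode_eq (h : Hist N m) (s : State N) :
    decode G am T αobj h s = if histWeight G am T αobj h = 0 then none else
      some fun b => histWeight G am T αobj (h ++ [(s, b)]) / histWeight G am T αobj h := by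
  rcases h.eq_nil_or_concat' with rfl | ⟨h, ⟨s₀, a₀⟩, rfl⟩
  · simp [histWeight_singleton, histWeight_nil, decode]
  · rw [decode_append, decodeFrom]
    simp only [histWeight_append, branches_append, weight_nextBranches]
    change (if ((dirs G am T s₀ a₀ _).map Prod.fst).sum = 0 then none else some fun b =>
      (((dirs G am T s₀ a₀ _).filter fun d => decide (best G am T s d.2 = b)).map
        Prod.fst).sum / ((dirs G am T s₀ a₀ _).map Prod.fst).sum) = _
    rw [sum_dirs_fst]

end branches

/-! ### Good branches -/

/-- The properties of the branches `x` of the decoder at the step `(s, a)`. -/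
structure GoodBranch (G : Game N m) (am : (Fin m → ℝ) → Fin m) (T : Table N m) (s : State N)
    (a : Fin m) (x : Branch) : Prop where
  nonneg : 0 ≤ x.w
  isDir : IsDir x.α
  ne : (T s a).p ≠ noPoint N
  eq : x.q = (T s a).p ∨ x.q = value G am T s a x.α

theorem weight_nonneg {G : Game N m} {am : (Fin m → ℝ) → Fin m} {T : Table N m} {s : State N}
    {a : Fin m} {bs : List Branch} (h : ∀ x ∈ bs, GoodBranch G am T s a x) : 0 ≤ weight bs :=
  List.sum_nonneg (by simpa using fun x hx => (h x hx).nonneg)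

theorem weightedSum_ge {G : Game N m} {am : (Fin m → ℝ) → Fin m} {T : Table N m} {s : State N}
    {a : Fin m} {bs : List Branch} (h : ∀ x ∈ bs, GoodBranch G am T s a x) {c : ℝ} {i : Player}
    (hc : ∀ x ∈ bs, c ≤ x.q i) : weight bs * c ≤ weightedSum i bs := by
  rw [weight, weightedSum, ← List.sum_map_mul_right]
  exact List.sum_le_sum fun x hx => mul_le_mul_of_nonneg_left (hc x hx) (h x hx).nonneg

section good

variable (G : Game N m) {σ : Player → State N → Fin m} {am : (Fin m → ℝ) → Fin m}
  {αobj : Pt} {ε : ℝ}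

local notation "tbl" => table G σ am αobj ε

theorem directions_good (hα : IsDir αobj) {s : State N} {a : Fin m} {x : Branch}
    (hx : GoodBranch G am tbl s a x) {d : ℝ × Pt} (hd : d ∈ directions G am tbl s a x) :
    0 ≤ d.1 ∧ IsDir d.2 := by
  rw [directions] at hd
  split_ifs at hd with hq
  · have hsp := table_splits G hα hx.ne
    have hdir := table_dirs G (σ := σ) (am := am) hα (ε := ε) s a
    rw [hq] at hd
    change d ∈ [(x.w * leftProb _ _ _, _), (x.w * (1 - leftProb _ _ _), _)] at hd
    rcases List.mem_pair.mp hd with rfl | rfl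
    · exact ⟨mul_nonneg hx.nonneg hsp.nonneg, hdir.1⟩
    · exact ⟨mul_nonneg hx.nonneg (sub_nonneg.mpr hsp.le_one), hdir.2⟩
  · rw [List.mem_singleton.mp hd]
    exact ⟨hx.nonneg, hx.isDir⟩

/-- Martingale property of the decoder. If `q = p`, this is `Splits`; if not, `q` is a value
different from `p`, hence the evaluation in the direction that is kept. -/
theorem sum_directions_eval (hα : IsDir αobj) {s : State N} {a : Fin m} {x : Branch}
    (hx : GoodBranch G am tbl s a x) (i : Player) :
    ((directions G am tbl s a x).map fun d => d.1 * eval G am tbl s a d.2 i).sum =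
      x.w * x.q i := by
  rw [directions]
  split_ifs with hq
  · have hsp := congrFun (table_splits G hα hx.ne).eq i
    rw [leftProb] at hsp
    simp only [Pi.add_apply, Pi.smul_apply, smul_eq_mul] at hsp
    rw [hq]
    simp only [List.map_cons, List.map_nil, List.sum_cons, List.sum_nil]
    rw [hsp]
    ring
  · have h := hx.eq.resolve_left hq
    have hE : x.q = eval G am tbl s a x.α := by
      rw [h, value]
      rw [h, value] at hq
      exact (maxAt_eq_or _ _ _).resolve_left hq
    simp [hE]

variable (hσ : ∀ i, IsPunishment G i (σ i))
  (ham : ∀ (f : Fin m → ℝ) (a : Fin m), f a ≤ f (am f)) (hα : IsDir αobj) (hε : 0 < ε)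

include hσ ham hα hε in
theorem nextBranches_good [NeZero m] {s : State N} {a : Fin m} {bs : List Branch}
    (h : ∀ x ∈ bs, GoodBranch G am tbl s a x) (t : State N) (b : Fin m) :
    ∀ y ∈ nextBranches G am tbl s a bs t b, GoodBranch G am tbl t b y := by
  intro y hy
  obtain ⟨d, hd, rfl⟩ := List.mem_map.mp hy
  obtain ⟨hd, hb⟩ := List.mem_filter.mp hd
  obtain ⟨x, hx, hd⟩ := List.mem_flatMap.mp hd
  obtain ⟨h₁, h₂⟩ := directions_good G hα (h x hx) hd
  refine ⟨h₁, h₂, ?_, Or.inr rfl⟩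
  rw [← of_decide_eq_true hb]
  exact (stateBound G hσ ham hα hε t).best_ne ham h₂

include hσ ham hα hε in
theorem branches_good [NeZero m] (h : Hist N m) (s : State N) (a : Fin m) :
    ∀ x ∈ branches G am tbl αobj (h ++ [(s, a)]), GoodBranch G am tbl s a x := by
  induction h using List.reverseRecOn generalizing s a with
  | nil =>
    intro x hx
    rw [List.nil_append, branches_singleton] at hx
    split_ifs at hx with ha
    · rw [List.mem_singleton.mp hx]
      refine ⟨zero_le_one, hα, fun hp => ?_, Or.inl rfl⟩
      have H := stateBound G hσ ham hα hε s
      obtain ⟨a', ha'⟩ := H.1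
      -- The first action is chosen by the score of `p` rather than of `value`, which is why
      -- `StateBound` covers both.
      have h₁ := ham (fun a => αobj ⬝ᵥ (tbl s a).p) a'
      have h₂ := hα.dotProduct_nonneg fun i => (H.2 a' αobj hα ha' _ (Or.inl rfl) i).1
      rw [← ha] at h₁
      rw [hp] at h₁
      exact absurd (hα.dotProduct_noPoint_neg N) (not_lt.mpr (h₂.trans h₁))
    · simp at hx
  | append_singleton h y ih =>
    rw [branches_append]
    exact nextBranches_good G hσ ham hα hε (ih y.1 y.2) s a

include hσ ham hα hε in
theorem histWeight_nonneg [NeZero m] (h : Hist N m) : 0 ≤ histWeight G am tbl αobj h := by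
  rcases h.eq_nil_or_concat' with rfl | ⟨h, ⟨s₀, a₀⟩, rfl⟩
  · rw [histWeight_nil]; exact zero_le_one
  · rw [histWeight_append]
    exact weight_nonneg (branches_good G hσ ham hα hε h s₀ a₀)

/-- A direction survives only for the `b` that it recommends, so `b` can be replaced by `best` and
the fibers reassembled. -/
theorem sum_weightedSum_nextBranches (T : Table N m) (s : State N) (a : Fin m)
    (bs : List Branch) (t : State N) (i : Player) :
    ∑ b, weightedSum i (nextBranches G am T s a bs t b) =
      ((dirs G am T s a bs).map fun d => d.1 * value G am T t (best G am T t d.2) d.2 i).sum := by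
  rw [← list_sum_fiber _ fun d => best G am T t d.2]
  refine Finset.sum_congr rfl fun b _ => ?_
  rw [weightedSum, nextBranches, List.map_map]
  congr 1
  refine List.map_congr_left fun d hd => ?_
  rw [of_decide_eq_true (List.mem_filter.mp hd).2]
  rfl

include hα in
-- Replace each `q` by the mean of the evaluations after splitting, then unfold each evaluation by
-- one step. This matches `expect_reward_succ`.
theorem weightedSum_eq {s : State N} (hs : s < Fin.last N) {a : Fin m} {bs : List Branch}
    (h : ∀ x ∈ bs, GoodBranch G am tbl s a x) (i : Player) :
    weightedSum i bs = G.r i s a * weight bs +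
      ∑ t, G.P s a t * ∑ b, weightedSum i (nextBranches G am tbl s a bs t b) := by
  have h₁ : weightedSum i bs =
      ((dirs G am tbl s a bs).map fun d => d.1 * eval G am tbl s a d.2 i).sum := by
    rw [dirs, list_sum_flatMap, weightedSum]
    congr 1
    exact List.map_congr_left fun x hx => (sum_directions_eval G hα (h x hx) i).symm
  rw [h₁, ← sum_dirs_fst G am tbl s a bs]
  simp only [sum_weightedSum_nextBranches]
  generalize dirs G am tbl s a bs = ds
  induction ds with
  | nil => simp
  | cons d ds ih =>
    simp only [List.map_cons, List.sum_cons, ih, mul_add, Finset.sum_add_distrib]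
    rw [eval_apply_of_lt G am _ hs, mul_add, Finset.mul_sum]
    have : ∑ t, d.1 * (if s < t then
          G.P s a t * value G am tbl t (best G am tbl t d.2) d.2 i else 0) =
        ∑ t, G.P s a t * (d.1 * value G am tbl t (best G am tbl t d.2) d.2 i) := by
      refine Finset.sum_congr rfl fun t _ => ?_
      split_ifs with ht
      · ring
      · rw [G.P_eq_zero_of_lt hs ht]; simp
    rw [this]
    ring

theorem weightedSum_last {a : Fin m} {bs : List Branch}
    (h : ∀ x ∈ bs, GoodBranch G am tbl (Fin.last N) a x) (i : Player) : weightedSum i bs = 0 := by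
  refine List.sum_eq_zero fun y hy => ?_
  obtain ⟨x, hx, rfl⟩ := List.mem_map.mp hy
  have hp : (tbl (Fin.last N) a).p = 0 := by rw [table_last]
  have : x.q = 0 := by
    rcases (h x hx).eq with hq | hq
    · rw [hq, hp]
    · rw [hq, value, eval_last, hp]
      exact (maxAt_eq_or _ _ _).elim id id
  simp [this]

end good

/-! ### Histories -/

theorem admits_append (π : Strategy N m) (h : Hist N m) (s : State N) (a : Fin m) :
    Admits π (h ++ [(s, a)]) ↔ Admits π h ∧ π h s = a := by
  constructor
  · intro H
    refine ⟨fun t ht => ?_, ?_⟩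
    · have := H t (by simp; omega)
      rwa [List.take_append_of_le_length ht.le, List.getElem_append_left ht] at this
    · simpa using H h.length (by simp)
  · rintro ⟨H, H'⟩ t ht
    rcases Nat.lt_or_ge t h.length with h' | h'
    · rw [List.take_append_of_le_length h'.le, List.getElem_append_left h']
      exact H t h'
    · obtain rfl : t = h.length := by simp at ht; omega
      simpa using H'

theorem isHist_append_iff (h : Hist N m) (s : State N) (a : Fin m) :
    IsHist (h ++ [(s, a)]) ↔ h.length ≤ N ∧ (h.map Prod.fst ++ [s]).IsChain Later := by
  simp [IsHist]

theorem IsHist.isHistState {h : Hist N m} {s : State N} {a : Fin m}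
    (H : IsHist (h ++ [(s, a)])) : IsHistState h s := by
  rw [isHist_append_iff] at H
  exact ⟨H.1.trans N.le_succ, H.2⟩

theorem IsHistState.isHist {h : Hist N m} {s : State N} (H : IsHistState h s) : IsHist h :=
  ⟨H.1, H.2.left_of_append⟩

theorem isHistState_append {h : Hist N m} {s t : State N} {a : Fin m}
    (H : IsHist (h ++ [(s, a)])) (ht : Later s t) : IsHistState (h ++ [(s, a)]) t := by
  refine ⟨H.1, ?_⟩
  have h2 := H.2
  simp only [List.map_append, List.map_cons, List.map_nil] at h2 ⊢
  rw [List.append_assoc, List.singleton_append, List.isChain_append_cons_cons]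
  exact ⟨h2, ht, List.isChain_singleton _⟩

theorem length_le_of_isChain {h : Hist N m} {s : State N} (hs : s < Fin.last N)
    (H : (h.map Prod.fst ++ [s]).IsChain Later) : h.length ≤ s.val := by
  induction h using List.reverseRecOn generalizing s with
  | nil => simp
  | append_singleton h y ih =>
    simp only [List.map_append, List.map_cons, List.map_nil] at H
    rw [List.append_assoc, List.singleton_append, List.isChain_append_cons_cons] at H
    obtain ⟨h1, h2, -⟩ := H
    have hlt : y.1 < s := h2.resolve_right fun h => hs.ne h.2
    have := ih (hlt.trans hs) h1
    have : y.1.val < s.val := hlt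
    simp
    omega

/-- States increase strictly before the terminal one, so a history reaching `s` has at most `s`
steps, and two more still fit the length bound. -/
theorem IsHist.append {h : Hist N m} {s t : State N} {a : Fin m} (H : IsHist (h ++ [(s, a)]))
    (hs : s < Fin.last N) (ht : s < t) (b : Fin m) : IsHist (h ++ [(s, a)] ++ [(t, b)]) := by
  have := isHistState_append H (Or.inl ht)
  rw [isHist_append_iff]
  refine ⟨?_, this.2⟩
  have h1 := length_le_of_isChain hs ((isHist_append_iff h s a).mp H).2
  have : s.val < N := hs
  simp
  omega

/-! ### The probability of admitting a history -/

/-- The probability that a strategy drawn from `μ` admits `h`. -/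
def admitProb (μ : RStrategy N m) (h : Hist N m) : ENNReal := μ.toOuterMeasure {π | Admits π h}

theorem admitProb_nil (μ : RStrategy N m) : admitProb μ [] = 1 := by
  rw [admitProb, PMF.toOuterMeasure_apply_eq_one_iff]
  exact fun π _ t ht => absurd ht (by simp)

theorem rAdmits_iff (μ : RStrategy N m) (h : Hist N m) : RAdmits μ h ↔ admitProb μ h ≠ 0 := by
  rw [admitProb, ne_eq, PMF.toOuterMeasure_apply_eq_zero_iff, Set.not_disjoint_iff]
  exact ⟨fun ⟨π, h₁, h₂⟩ => ⟨π, h₂, h₁⟩, fun ⟨π, h₁, h₂⟩ => ⟨π, h₂, h₁⟩⟩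

theorem admitProb_append_le (μ : RStrategy N m) (h : Hist N m) (s : State N) (a : Fin m) :
    admitProb μ (h ++ [(s, a)]) ≤ admitProb μ h :=
  μ.toOuterMeasure.mono fun _ hπ => ((admits_append _ h s a).mp hπ).1

theorem admitProb_ne_top (μ : RStrategy N m) (h : Hist N m) : admitProb μ h ≠ ⊤ := by
  refine ne_top_of_le_ne_top ENNReal.one_ne_top ?_
  rw [admitProb, ← (PMF.toOuterMeasure_apply_eq_one_iff μ (s := Set.univ)).mpr (Set.subset_univ _)]
  exact μ.toOuterMeasure.mono (Set.subset_univ _)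

theorem cond_apply (μ : RStrategy N m) {h : Hist N m} (H : RAdmits μ h) (π : Strategy N m) :
    cond μ h H π = {π | Admits π h}.indicator μ π * (admitProb μ h)⁻¹ := by
  rw [admitProb, PMF.toOuterMeasure_apply]
  exact PMF.filter_apply H π

theorem cond_map_apply (μ : RStrategy N m) {h : Hist N m} (H : RAdmits μ h) (s : State N)
    (a : Fin m) : ((cond μ h H).map fun π => π h s) a =
      admitProb μ (h ++ [(s, a)]) / admitProb μ h := by
  rw [PMF.map_apply, div_eq_mul_inv, admitProb, PMF.toOuterMeasure_apply, ← ENNReal.tsum_mul_right]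
  refine tsum_congr fun π => ?_
  rw [cond_apply]
  by_cases h₁ : Admits π h <;> by_cases h₂ : a = π h s <;>
    simp [Set.indicator, admits_append, h₁, h₂, Ne.symm]

/-! ### Decoders given by history weights -/

/-- The decoder whose output has probabilities proportional to the weights of the one-step
extensions of the history. -/
def decodeOf (W : Hist N m → ℝ) (h : Hist N m) (s : State N) : Option (Fin m → ℝ) :=
  if W h = 0 then none else some fun b => W (h ++ [(s, b)]) / W h

/-- `W h` are the probabilities of following the histories `h`, given the states. -/
structure IsHistWeight (W : Hist N m → ℝ) : Prop where
  nil : W [] = 1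
  nonneg : ∀ h, 0 ≤ W h
  sum : ∀ h s, ∑ b, W (h ++ [(s, b)]) = W h

theorem IsHistWeight.append_eq_zero {W : Hist N m → ℝ} (hW : IsHistWeight W) {h : Hist N m}
    (h0 : W h = 0) (s : State N) (a : Fin m) : W (h ++ [(s, a)]) = 0 := by
  have := hW.sum h s
  rw [h0, Finset.sum_eq_zero_iff_of_nonneg fun _ _ => hW.nonneg _] at this
  exact this a (Finset.mem_univ a)

/-- The decoder prescribes the conditional probability of each next action; by induction the
products telescope to `W h`. Past an inadmissible prefix both sides are zero. -/
theorem IsHistWeight.toReal_admitProb {W : Hist N m → ℝ} (hW : IsHistWeight W)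
    {μ : RStrategy N m} (hμ : IsDecoded (decodeOf W) μ) {h : Hist N m} (hh : IsHist h) :
    (admitProb μ h).toReal = W h := by
  induction h using List.reverseRecOn with
  | nil => rw [admitProb_nil, hW.nil, ENNReal.toReal_one]
  | append_singleton h y ih =>
    obtain ⟨s, a⟩ := y
    have hst := hh.isHistState
    have IH := ih hst.isHist
    obtain ⟨h₁, h₂⟩ := hμ h s hst
    by_cases H : RAdmits μ h
    · have hne : W h ≠ 0 := by
        rw [← IH]
        exact ENNReal.toReal_ne_zero.mpr ⟨(rAdmits_iff μ h).mp H, admitProb_ne_top μ h⟩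
      have h₃ := h₁ H
      rw [decodeOf, if_neg hne, Option.some_inj] at h₃
      have h₄ := congrFun h₃ a
      rw [cond_map_apply, ENNReal.toReal_div, IH] at h₄
      exact (div_left_inj' hne).mp h₄.symm
    · have h0 : admitProb μ h = 0 := not_not.mp (mt (rAdmits_iff μ h).mpr H)
      have h1 : admitProb μ (h ++ [(s, a)]) = 0 :=
        le_antisymm ((admitProb_append_le μ h s a).trans h0.le) zero_le
      rw [h0, ENNReal.toReal_zero] at IH
      rw [h1, hW.append_eq_zero IH.symm, ENNReal.toReal_zero]

/-- Product distributions. -/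
theorem exists_pmf_pi {ι A : Type*} [Fintype ι] [Fintype A] (β : ι → PMF A) :
    ∃ μ : PMF (ι → A), ∀ S : ι → Set A,
      μ.toOuterMeasure {g | ∀ i, g i ∈ S i} = ∏ i, (β i).toOuterMeasure (S i) := by
  classical
  have key : ∀ S : ι → Set A, ∑ g : ι → A, {g | ∀ i, g i ∈ S i}.indicator
      (fun g => ∏ i, β i (g i)) g = ∏ i, (β i).toOuterMeasure (S i) := by
    intro S
    simp only [PMF.toOuterMeasure_apply_fintype]
    rw [Fintype.prod_sum]
    refine Finset.sum_congr rfl fun g _ => ?_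
    by_cases hg : ∀ i, g i ∈ S i
    · rw [Set.indicator_of_mem (show g ∈ {g | ∀ i, g i ∈ S i} from hg)]
      exact Finset.prod_congr rfl fun i _ => (Set.indicator_of_mem (hg i) _).symm
    · rw [Set.indicator_of_notMem (show g ∉ {g | ∀ i, g i ∈ S i} from hg)]
      obtain ⟨i, hi⟩ := not_forall.mp hg
      exact (Finset.prod_eq_zero (Finset.mem_univ i) (Set.indicator_of_notMem hi _)).symm
  have hone : ∑ g : ι → A, ∏ i, β i (g i) = 1 := by
    rw [← Fintype.prod_sum]
    refine Finset.prod_eq_one fun i _ => ?_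
    rw [← (β i).tsum_coe, tsum_fintype]
  exact ⟨PMF.ofFintype _ hone, fun S => by rw [PMF.toOuterMeasure_apply_fintype, ← key]; rfl⟩

/-- Independent choices at the finitely many pairs `(h, s)` with `h` of length at most `N + 1`.
Admitting a history constrains distinct coordinates, one per step, so its probability is the
telescoping product of the quotients of weights. -/
theorem IsHistWeight.exists_isDecoded [NeZero m] {W : Hist N m → ℝ} (hW : IsHistWeight W) :
    ∃ μ : RStrategy N m, IsDecoded (decodeOf W) μ := by
  classical
  set I := {x : Hist N m × State N // x.1.length ≤ N + 1} with hI
  have : Finite I := by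
    have h1 : {l : Hist N m | l.length ≤ N + 1}.Finite := List.finite_length_le _ _
    exact ((h1.prod (Set.finite_univ (α := State N))).subset
      fun x hx => ⟨hx, Set.mem_univ _⟩).to_subtype
  have := Fintype.ofFinite I
  -- The product form also covers weight zero, where all extensions have weight zero and any
  -- distribution will do.
  have hβ : ∀ x : Hist N m × State N, ∃ β : PMF (Fin m),
      ∀ a, ENNReal.ofReal (W x.1) * β a = ENNReal.ofReal (W (x.1 ++ [(x.2, a)])) := by
    intro x
    rcases eq_or_lt_of_le (hW.nonneg x.1) with h0 | hpos
    · exact ⟨PMF.pure 0, fun a => by rw [← h0, hW.append_eq_zero h0.symm]; simp⟩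
    · refine ⟨PMF.ofFintype (fun a => ENNReal.ofReal (W (x.1 ++ [(x.2, a)]) / W x.1)) ?_, ?_⟩
      · rw [← ENNReal.ofReal_sum_of_nonneg fun a _ => div_nonneg (hW.nonneg _) hpos.le,
          ← Finset.sum_div, hW.sum, div_self hpos.ne', ENNReal.ofReal_one]
      · intro a
        rw [PMF.ofFintype_apply, ← ENNReal.ofReal_mul hpos.le, mul_div_cancel₀ _ hpos.ne']
  choose β hβ using hβ
  obtain ⟨ν, hν⟩ := exists_pmf_pi fun x : I => β x.1
  set strat : (I → Fin m) → Strategy N m :=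
    fun g h s => if hl : h.length ≤ N + 1 then g ⟨(h, s), hl⟩ else 0 with hstrat
  -- Admitting `h` is a box event. Coordinates at histories at least as long as `h` are free, so the
  -- next step restricts a fresh factor. The bound `N + 2` allows one action after a history of
  -- maximal length.
  have key : ∀ h : Hist N m, h.length ≤ N + 2 → ∃ S : I → Set (Fin m),
      (∀ g, Admits (strat g) h ↔ ∀ x, g x ∈ S x) ∧
      (∀ x : I, h.length ≤ x.1.1.length → S x = Set.univ) ∧
      ∏ x, (β x.1).toOuterMeasure (S x) = ENNReal.ofReal (W h) := by
    intro h
    induction h using List.reverseRecOn with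
    | nil =>
      refine fun _ => ⟨fun _ => Set.univ, fun g => ?_, fun _ _ => rfl, ?_⟩
      · simp [Admits]
      · rw [hW.nil, ENNReal.ofReal_one]
        exact Finset.prod_eq_one fun x _ =>
          (PMF.toOuterMeasure_apply_eq_one_iff _ _).mpr (Set.subset_univ _)
    | append_singleton h y ih =>
      obtain ⟨s, a⟩ := y
      intro hl
      have hl' : h.length ≤ N + 1 := by simpa using hl
      obtain ⟨S, h₁, h₂, h₃⟩ := ih (by omega)
      set x₀ : I := ⟨(h, s), hl'⟩
      have hx₀ : S x₀ = Set.univ := h₂ x₀ le_rfl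
      refine ⟨Function.update S x₀ {a}, fun g => ?_, fun x hx => ?_, ?_⟩
      · have hg : strat g h s = g x₀ := by simp [hstrat, hl', x₀]
        rw [admits_append, h₁, hg]
        constructor
        · rintro ⟨h', rfl⟩ x
          by_cases hx : x = x₀
          · subst hx; simp
          · rw [Function.update_of_ne hx]; exact h' x
        · intro h'
          refine ⟨fun x => ?_, by simpa using h' x₀⟩
          by_cases hx : x = x₀
          · rw [hx, hx₀]; trivial
          · simpa [Function.update_of_ne hx] using h' x
      · have hne : x ≠ x₀ := by
          rintro rfl
          simp [x₀] at hx
        rw [Function.update_of_ne hne]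
        exact h₂ x (by simp at hx; omega)
      · rw [← hβ (h, s) a, ← h₃, ← Finset.mul_prod_erase _ _ (Finset.mem_univ x₀),
          ← Finset.mul_prod_erase _ _ (Finset.mem_univ x₀), Function.update_self, hx₀,
          PMF.toOuterMeasure_apply_singleton,
          (PMF.toOuterMeasure_apply_eq_one_iff _ _).mpr (Set.subset_univ _), one_mul, mul_comm]
        congr 1
        refine Finset.prod_congr rfl fun x hx => ?_
        rw [Function.update_of_ne (Finset.ne_of_mem_erase hx)]
  have hM : ∀ h : Hist N m, h.length ≤ N + 2 →
      admitProb (ν.map strat) h = ENNReal.ofReal (W h) := by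
    intro h hl
    obtain ⟨S, h₁, -, h₃⟩ := key h hl
    rw [admitProb, PMF.toOuterMeasure_map_apply, ← h₃, ← hν]
    congr 1
    ext g
    exact h₁ g
  refine ⟨ν.map strat, fun h s hhs => ⟨fun H => ?_, fun H => ?_⟩⟩
  · have hne := (rAdmits_iff _ _).mp H
    rw [hM h (hhs.1.trans (by omega)), ne_eq, ENNReal.ofReal_eq_zero, not_le] at hne
    rw [decodeOf, if_neg hne.ne']
    congr 1
    funext a
    have hl := hhs.1
    rw [cond_map_apply, hM h (by omega), hM _ (by simp; omega), ENNReal.toReal_div,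
      ENNReal.toReal_ofReal (hW.nonneg _), ENNReal.toReal_ofReal (hW.nonneg _)]
  · have h0 := not_not.mp (mt (rAdmits_iff _ _).mpr H)
    rw [hM h (hhs.1.trans (by omega)), ENNReal.ofReal_eq_zero] at h0
    rw [decodeOf, if_pos (le_antisymm h0 (hW.nonneg h))]

/-! ### Utilities as sums over branches -/

/-- The expectation of `f` over the strategies drawn from `μ` that admit `h` (not normalized). -/
def expect (μ : RStrategy N m) (h : Hist N m) (f : Strategy N m → ℝ) : ℝ :=
  ∑' π, (μ π).toReal * {π | Admits π h}.indicator f π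

theorem summable_toReal (μ : RStrategy N m) : Summable fun π => (μ π).toReal :=
  ENNReal.summable_toReal (by rw [μ.tsum_coe]; exact ENNReal.one_ne_top)

/-- There may be infinitely many strategies, so splitting these expectations requires summability;
boundedness of the utilities supplies it. -/
theorem hasSum_expect (μ : RStrategy N m) (h : Hist N m) {f : Strategy N m → ℝ} {c : ℝ}
    (hf : ∀ π, |f π| ≤ c) :
    HasSum (fun π => (μ π).toReal * {π | Admits π h}.indicator f π) (expect μ h f) := by
  refine Summable.hasSum (Summable.of_norm_bounded ((summable_toReal μ).mul_right c) fun π => ?_)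
  have hc : 0 ≤ c := (abs_nonneg _).trans (hf π)
  rw [norm_mul, Real.norm_of_nonneg ENNReal.toReal_nonneg]
  refine mul_le_mul_of_nonneg_left ?_ ENNReal.toReal_nonneg
  by_cases hπ : Admits π h
  · rw [Set.indicator_of_mem (show π ∈ {π | Admits π h} from hπ)]; exact hf π
  · rw [Set.indicator_of_notMem (show π ∉ {π | Admits π h} from hπ), norm_zero]; exact hc

theorem expect_const (μ : RStrategy N m) (h : Hist N m) (c : ℝ) :
    expect μ h (fun _ => c) = c * (admitProb μ h).toReal := by
  rw [admitProb, PMF.toOuterMeasure_apply, ENNReal.tsum_toReal_eq, expect, ← tsum_mul_left]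
  · refine tsum_congr fun π => ?_
    by_cases hπ : Admits π h <;> simp [Set.indicator, hπ, mul_comm]
  · intro π
    by_cases hπ : Admits π h <;> simp [Set.indicator, hπ, μ.apply_ne_top]

theorem utilUncond_cond (G : Game N m) (μ : RStrategy N m) (i : Player) {h : Hist N m}
    (H : RAdmits μ h) (h' : Hist N m) (s : State N) :
    utilUncond G (cond μ h H) i h' s =
      expect μ h (fun π => utilDet G π i h' s) / (admitProb μ h).toReal := by
  rw [utilUncond, expect, ← tsum_div_const]
  refine tsum_congr fun π => ?_
  rw [cond_apply]
  by_cases hπ : Admits π h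
  · simp [Set.indicator, hπ, ENNReal.toReal_mul]
    ring
  · simp [Set.indicator, hπ]

theorem abs_reward_le (G : Game N m) (i : Player) (π : Strategy N m) (k : ℕ) (h : Hist N m)
    (s : State N) : |reward G (G.r i) π k h s| ≤ k := by
  induction k generalizing h s with
  | zero => simp [reward]
  | succ k ih =>
    rw [reward]
    have h₁ : |G.r i s (π h s)| ≤ 1 := abs_le.mpr
      ⟨by linarith [G.r_nonneg i s (π h s)], G.r_le_one i s (π h s)⟩
    have h₂ : |∑ t, G.P s (π h s) t * reward G (G.r i) π k (h ++ [(s, π h s)]) t| ≤ k := by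
      refine (Finset.abs_sum_le_sum_abs _ _).trans ?_
      calc _ ≤ ∑ t, G.P s (π h s) t * (k : ℝ) := by
            refine Finset.sum_le_sum fun t _ => ?_
            rw [abs_mul, abs_of_nonneg (G.P_nonneg _ _ _)]
            exact mul_le_mul_of_nonneg_left (ih _ _) (G.P_nonneg _ _ _)
        _ = k := by rw [← Finset.sum_mul, G.P_sum, one_mul]
    push_cast
    linarith [abs_add_le (G.r i s (π h s))
      (∑ t, G.P s (π h s) t * reward G (G.r i) π k (h ++ [(s, π h s)]) t)]

theorem expect_eq_sum (μ : RStrategy N m) (h : Hist N m) (s : State N) {f : Strategy N m → ℝ}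
    {c : ℝ} (hf : ∀ π, |f π| ≤ c) : expect μ h f = ∑ b, expect μ (h ++ [(s, b)]) f := by
  refine HasSum.unique (hasSum_expect μ h hf) ?_
  convert hasSum_sum fun b (_ : b ∈ Finset.univ) => hasSum_expect μ (h ++ [(s, b)]) hf using 2
    with π
  rw [← Finset.mul_sum]
  congr 1
  by_cases hπ : Admits π h <;> simp [Set.indicator, admits_append, hπ]

/-- Strategies admitting `h ++ [(s, a)]` play `a` at `(h, s)`, so the first reward and the
transition law are common to all of them; the rest is split by the action played in `t`. -/
theorem expect_reward_succ (G : Game N m) (i : Player) (μ : RStrategy N m) (k : ℕ) (h : Hist N m)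
    (s : State N) (a : Fin m) :
    expect μ (h ++ [(s, a)]) (fun π => reward G (G.r i) π (k + 1) h s) =
      G.r i s a * (admitProb μ (h ++ [(s, a)])).toReal +
        ∑ t, G.P s a t * ∑ b, expect μ (h ++ [(s, a)] ++ [(t, b)])
          (fun π => reward G (G.r i) π k (h ++ [(s, a)]) t) := by
  rw [← expect_const]
  refine HasSum.unique (hasSum_expect μ _ fun π => abs_reward_le G i π (k + 1) h s) ?_
  have h₁ : ∀ t, HasSum _ _ := fun t =>
    (hasSum_expect μ (h ++ [(s, a)]) fun π => abs_reward_le G i π k (h ++ [(s, a)]) t).mul_left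
      (G.P s a t)
  convert (hasSum_expect μ (h ++ [(s, a)]) (f := fun _ => G.r i s a) fun _ => le_rfl).add
    (hasSum_sum fun t (_ : t ∈ Finset.univ) => h₁ t) using 2 with π
  · by_cases hπ : Admits π (h ++ [(s, a)])
    · have ha := ((admits_append π h s a).mp hπ).2
      simp only [Set.indicator, Set.mem_ofPred_eq, hπ, if_true, reward, ha]
      rw [mul_add, Finset.mul_sum]
      congr 1
      exact Finset.sum_congr rfl fun t _ => by ring
    · simp [Set.indicator, hπ]
  · exact Finset.sum_congr rfl fun t _ => by
      rw [expect_eq_sum μ (h ++ [(s, a)]) t fun π => abs_reward_le G i π k (h ++ [(s, a)]) t]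

theorem decode_eq_decodeOf (G : Game N m) (am : (Fin m → ℝ) → Fin m) (T : Table N m)
    (αobj : Pt) :
    decode G am T αobj = decodeOf (histWeight G am T αobj) := by
  funext h s
  exact decode_eq G am T αobj h s

/-! ### Expected utilities of the decoded strategies, feasibility and the objective value -/

section main

variable [NeZero m] (G : Game N m) {σ : Player → State N → Fin m} {am : (Fin m → ℝ) → Fin m}
  {αobj : Pt} {ε : ℝ} (hσ : ∀ i, IsPunishment G i (σ i))
  (ham : ∀ (f : Fin m → ℝ) (a : Fin m), f a ≤ f (am f)) (hα : IsDir αobj) (hε : 0 < ε)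

local notation "tbl" => table G σ am αobj ε

include hσ ham hα hε in
theorem isHistWeight : IsHistWeight (histWeight G am tbl αobj) where
  nil := histWeight_nil G am _ αobj
  nonneg := histWeight_nonneg G hσ ham hα hε
  sum := sum_histWeight_append G am _ αobj

include hσ ham hα hε in
theorem toReal_admitProb_eq_weight {μ : RStrategy N m} (hμ : IsDecoded (decode G am tbl αobj) μ)
    {h : Hist N m} {s : State N} {a : Fin m} (H : IsHist (h ++ [(s, a)])) :
    (admitProb μ (h ++ [(s, a)])).toReal = weight (branches G am tbl αobj (h ++ [(s, a)])) := by
  rw [decode_eq_decodeOf] at hμ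
  rw [(isHistWeight G hσ ham hα hε).toReal_admitProb hμ H, histWeight_append]

include hσ ham hα hε in
-- Induction on the horizon, matching `expect_reward_succ` with `weightedSum_eq`. The condition on
-- `k` ensures that play reaches the terminal state, where both sides vanish, before the horizon
-- ends.
theorem expect_reward_eq {μ : RStrategy N m} (hμ : IsDecoded (decode G am tbl αobj) μ)
    (i : Player) (k : ℕ) {h : Hist N m} {s : State N} {a : Fin m} (H : IsHist (h ++ [(s, a)]))
    (hk : N ≤ s.val + k) :
    expect μ (h ++ [(s, a)]) (fun π => reward G (G.r i) π k h s) =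
      weightedSum i (branches G am tbl αobj (h ++ [(s, a)])) := by
  have hgood := fun h s a => branches_good G hσ ham hα hε (h := h) (s := s) (a := a)
  induction k generalizing h s a with
  | zero =>
    obtain rfl : s = Fin.last N := Fin.ext (by have := s.isLt; simp; omega)
    rw [weightedSum_last G (hgood h _ a)]
    exact (expect_const μ _ 0).trans (zero_mul _)
  | succ k ih =>
    rcases (Fin.le_last s).eq_or_lt with rfl | hs
    · simp only [reward_last G (G.term_r i)]
      rw [weightedSum_last G (hgood h _ a), expect_const, zero_mul]
    · rw [expect_reward_succ, toReal_admitProb_eq_weight G hσ ham hα hε hμ H,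
        weightedSum_eq G hα hs (hgood h s a)]
      congr 1
      refine Finset.sum_congr rfl fun t _ => ?_
      by_cases hst : s < t
      · congr 1
        refine Finset.sum_congr rfl fun b _ => ?_
        have : s.val < t.val := hst
        rw [ih (H.append hs hst b) (by omega), branches_append]
      · rw [G.P_eq_zero_of_lt hs hst, zero_mul, zero_mul]

include hσ ham hα hε in
-- The conditional utility is the weighted average of the points `q` of the branches, each of which
-- meets the bound by `punUtil_sub_le`.
theorem feasible_of_isDecoded {μ : RStrategy N m}
    (hμ : IsDecoded (decode G am tbl αobj) μ) : Feasible G σ ε μ := by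
  intro h s a hh H
  have hgood := branches_good G hσ ham hα hε h s a
  have hw := toReal_admitProb_eq_weight G hσ ham hα hε hμ hh
  have hpos : 0 < (admitProb μ (h ++ [(s, a)])).toReal :=
    ENNReal.toReal_pos ((rAdmits_iff _ _).mp H) (admitProb_ne_top _ _)
  rw [utilUncond_cond, le_div_iff₀ hpos, mul_comm, hw]
  refine (weightedSum_ge hgood fun x hx => ?_).trans_eq
    (expect_reward_eq G hσ ham hα hε hμ (G.ap s) (N + 1) hh (by omega)).symm
  exact punUtil_sub_le G hσ ham hα hε (hgood x hx).isDir (hgood x hx).ne (hgood x hx).eq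

include hσ ham hα hε in
-- After the first step only the action maximizing the objective has a branch: weight `1`, with `q =
-- p`.
theorem util_nil_eq {μ : RStrategy N m} (hμ : IsDecoded (decode G am tbl αobj) μ) (s : State N)
    (i : Player) :
    util G μ i [] (rAdmits_nil μ) s = (tbl s (am fun a => αobj ⬝ᵥ (tbl s a).p)).p i := by
  rw [util, utilUncond_cond, admitProb_nil, ENNReal.toReal_one, div_one,
    expect_eq_sum μ [] s (f := fun π => utilDet G π i [] s) fun π => abs_reward_le G i π (N + 1) [] s]
  have h : ∀ b, expect μ ([] ++ [(s, b)]) (fun π => utilDet G π i [] s) =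
      weightedSum i (branches G am tbl αobj ([] ++ [(s, b)])) := fun b =>
    expect_reward_eq G hσ ham hα hε hμ i (N + 1) (by simp [IsHist]) (by omega)
  rw [Finset.sum_congr rfl fun b _ => h b]
  simp only [List.nil_append, branches_singleton]
  rw [Finset.sum_eq_single (am fun a => αobj ⬝ᵥ (tbl s a).p)]
  · simp [weightedSum]
  · intro b _ hb
    rw [if_neg hb]
    rfl
  · simp

theorem opt_eq (ham : ∀ (f : Fin m → ℝ) (a : Fin m), f a ≤ f (am f)) :
    opt G σ am αobj ε = αobj ⬝ᵥ (tbl 0 (am fun a => αobj ⬝ᵥ (tbl 0 a).p)).p :=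
  le_antisymm (ciSup_le fun a => ham (fun a => αobj ⬝ᵥ (tbl 0 a).p) a)
    (le_ciSup (f := fun a => αobj ⬝ᵥ (tbl 0 a).p) (Set.finite_range _).bddAbove _)

end main

end TurnTaking

end

theorem mainTheorem6 (N m : ℕ) [NeZero m] (G : TurnTaking.Game N m)
    (σ : TurnTaking.Player → TurnTaking.State N → Fin m)
    (hσ : ∀ i, TurnTaking.IsPunishment G i (σ i))
    (am : (Fin m → ℝ) → Fin m) (ham : ∀ (f : Fin m → ℝ) (a : Fin m), f a ≤ f (am f))
    (αobj : TurnTaking.Pt) (hα_nonneg : ∀ i, 0 ≤ αobj i) (hα_ne : αobj ≠ 0)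
    (hα_norm : TurnTaking.norm1 αobj ≤ 1)
    (ε : ℝ) (hε : 0 < ε) :
    (∃ μ : TurnTaking.RStrategy N m,
      TurnTaking.IsDecoded
        (TurnTaking.decode G am (TurnTaking.table G σ am αobj ε) αobj) μ) ∧
    ∀ μ : TurnTaking.RStrategy N m,
      TurnTaking.IsDecoded
        (TurnTaking.decode G am (TurnTaking.table G σ am αobj ε) αobj) μ →
      TurnTaking.Feasible G σ ε μ ∧
      αobj ⬝ᵥ (fun i => TurnTaking.util G μ i [] (TurnTaking.rAdmits_nil μ) 0) =
        TurnTaking.opt G σ am αobj ε := by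

  have hα : TurnTaking.IsDir αobj := by
    refine ⟨hα_nonneg, ?_⟩
    obtain ⟨i, hi⟩ := Function.ne_iff.mp hα_ne
    exact ⟨i, lt_of_le_of_ne (hα_nonneg i) (Ne.symm hi)⟩
  refine ⟨?_, fun μ hμ => ⟨TurnTaking.feasible_of_isDecoded G hσ ham hα hε hμ, ?_⟩⟩
  · rw [TurnTaking.decode_eq_decodeOf]
    exact (TurnTaking.isHistWeight G hσ ham hα hε).exists_isDecoded
  · rw [TurnTaking.opt_eq G ham]
    simp only [TurnTaking.util_nil_eq G hσ ham hα hε hμ]
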